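/- Let $d\ge 1$. The sample is a system of fermions on $\mathcal H_s=\ell^2(\{0,\dots,d-1\})$ with canonical basis $e_j$ and creation/annihilation operators $a_j^*,a_j$ on the antisymmetric Fock space $\mathcal F_-(\mathcal H_s)$; $\mathcal A$ is the algebra of all operators on $\mathcal F_-(\mathcal H_s)$, and $N_s=\sum_j a_j^*a_j$. The reservoir is a system of fermions on $\mathcal H_r=\ell^2(\mathbb Z)$ with canonical basis $\Psi_j$ and operators $b_j^*,b_j$ on $\mathcal F_-(\mathcal H_r)$; $\mathcal B$ is the $C^*$-algebra generated by all $b^*(\phi),b(\phi)$, $\phi\in\mathcal H_r$. One time step on $\mathcal F_-(\mathcal H_r)\otimes\mathcal F_-(\mathcal H_s)$ is given by $U=(\Gamma(S)\otimes\Gamma(S_p))K$, where $\Gamma$ is second quantization, $S\Psi_j=\Psi_{j-1}$, $S_pe_j=e_{j-1}$ with $S_pe_0=e_{d-1}$, and $K=\exp[-i\alpha(b_0^*\otimes a_0+b_0\otimes a_0^*)]$ with $\alpha\in\mathbb R$; put $\tau^t(X)=U^{*t}XU^t$ for $X\in\mathcal B\otimes\mathcal A$. Let $\sigma\in[0,1]$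 and let $\omega$ be the gauge-invariant quasi-free state on $\mathcal B$ with density $\Sigma=\sigma\mathbb I$, i.e. $\omega(b^*(\phi_m)\cdots b^*(\phi_1)b(\psi_1)\cdots b(\psi_n))=\delta_{nm}\det\{\langle\psi_j,\Sigma\phi_k\rangle\}$. For a density matrix $\rho$ on $\mathcal F_-(\mathcal H_s)$ put $\rho_t(A)=(\omega\otimes\rho)(\tau^t(\mathbb I\otimes A))$ for $A\in\mathcal A$, and let $\rho_t^{(p)}$ be the operator on $\mathcal H_s^{\wedge p}$ with $$\langle e_{j_1}\wedge\cdots\wedge e_{j_p}|\rho^{(p)}_t\,e_{k_1}\wedge\cdots\wedge e_{k_p}\rangle=\rho_t(a_{k_1}^*\cdots a_{k_p}^*a_{j_p}\cdots a_{j_1}).$$ **Proposition.** Assume $|\cos\alpha|<1$. Then for every initial density matrix $\rho$ of the sample, as $m\to\infty$ along the times $t=md$: (i) for all $p\in\{1,\dots,d\}$, $\rho^{(p)}_{md}\to\rho^{(p)}_\infty=\sigma^p\,\mathbb I_{\mathcal H_s^{\wedge p}}$; (ii) if $0<\sigma<1$, then with $\mu=\ln\frac{1-\sigma}{\sigma}$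 and $Z(\mu)=\operatorname{tr}e^{-\mu N_s}$ one has $Z(\mu)=(1-\sigma)^{-d}$, and $\rho_{md}(A)\to\operatorname{tr}(\rho_\infty A)$ for every $A\in\mathcal A$, where $\rho_\infty=e^{-\mu N_s}/Z(\mu)$; (iii) the number of particles in the sample is asymptotically binomial $B(d,\sigma)$: if $P_p$ denotes the orthogonal projection onto the eigenspace $N_s=p$, then $\rho_{md}(P_p)\to\binom dp\sigma^p(1-\sigma)^{d-p}$ for every $p\in\mathbb N$. -/

import Mathlib

open scoped lp ComplexOrder InnerProductSpace
open Filter Topology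

noncomputable section

namespace FermionWalk

/-! ### Fermionic Fock space in the occupation number basis -/

/-- The antisymmetric Fock space over `ℓ²(ι)`, `ι` linearly ordered.  The basis vector indexed by the
finite set `A = {i₁ < ⋯ < i_q}` is the normalized elementary vector `e_{i₁} ∧ ⋯ ∧ e_{i_q}`; the
vacuum is indexed by `∅`. -/
abbrev Fock (ι : Type*) : Type _ := ℓ²(Finset ι, ℂ)

section Fock

variable {ι : Type*} [LinearOrder ι]

/-- The basis vector `e_{i₁} ∧ ⋯ ∧ e_{i_q}` for `A = {i₁ < ⋯ < i_q}`. -/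
def basisVec (A : Finset ι) : Fock ι := lp.single 2 A (1 : ℂ)

/-- The operator `f ↦ (x ↦ w x * f (h x))` on `ℓ²`, for `|w| ≤ 1` and `h` injective where `w ≠ 0`. -/
def weightedComp {X : Type*} (w : X → ℂ) (h : X → X) (hw : ∀ x, ‖w x‖ ≤ 1)
    (hh : Set.InjOn h {x | w x ≠ 0}) : ℓ²(X, ℂ) →L[ℂ] ℓ²(X, ℂ) :=
  have key : ∀ (f : ℓ²(X, ℂ)) (s : Finset X),
      ∑ x ∈ s, ‖w x * f (h x)‖ ^ (2 : ENNReal).toReal ≤ ‖f‖ ^ (2 : ENNReal).toReal := by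
    classical
    intro f s
    calc ∑ x ∈ s, ‖w x * f (h x)‖ ^ (2 : ENNReal).toReal
        = ∑ x ∈ s with w x ≠ 0, ‖w x * f (h x)‖ ^ (2 : ENNReal).toReal := by
          rw [Finset.sum_filter]
          refine Finset.sum_congr rfl fun x _ => ?_
          by_cases hx : w x = 0 <;> simp [hx]
      _ ≤ ∑ x ∈ s with w x ≠ 0, ‖f (h x)‖ ^ (2 : ENNReal).toReal := by
          refine Finset.sum_le_sum fun x _ => ?_
          refine Real.rpow_le_rpow (norm_nonneg _) ?_ (by norm_num)
          rw [norm_mul]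
          exact mul_le_of_le_one_left (norm_nonneg _) (hw x)
      _ = ∑ y ∈ (s.filter fun x => w x ≠ 0).image h, ‖f y‖ ^ (2 : ENNReal).toReal := by
          rw [Finset.sum_image]
          intro x hx y hy hxy
          exact hh (Finset.mem_filter.1 hx).2 (Finset.mem_filter.1 hy).2 hxy
      _ ≤ ‖f‖ ^ (2 : ENNReal).toReal := lp.sum_rpow_le_norm_rpow (by norm_num) f _
  LinearMap.mkContinuous
    { toFun := fun f => ⟨fun x => w x * f (h x), memℓp_gen' (key f)⟩
      map_add' := fun f g => by
        ext x
        exact mul_add (w x) (f (h x)) (g (h x))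
      map_smul' := fun c f => by
        ext x
        exact mul_left_comm (w x) c (f (h x)) } 1
    (fun f => by
      rw [one_mul]
      exact lp.norm_le_of_forall_sum_le (by norm_num) (norm_nonneg f) (key f))

@[simp] theorem weightedComp_apply {X : Type*} (w : X → ℂ) (h : X → X) (hw : ∀ x, ‖w x‖ ≤ 1)
    (hh : Set.InjOn h {x | w x ≠ 0}) (f : ℓ²(X, ℂ)) (x : X) :
    weightedComp w h hw hh f x = w x * f (h x) := rfl

/-- The fermionic sign `(-1) ^ #{k ∈ A | k < i}`. -/
def fermiSign (i : ι) (A : Finset ι) : ℂ := (-1) ^ (A.filter (· < i)).card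

theorem norm_fermiSign (i : ι) (A : Finset ι) : ‖fermiSign i A‖ = 1 := by simp [fermiSign]

/-- The annihilation operator `c_i = c(e_i)`, acting by
`c_i (e_{i₁} ∧ ⋯ ∧ e_{i_q}) = (-1)^(j-1) e_{i₁} ∧ ⋯ (omit e_{i_j}) ⋯ ∧ e_{i_q}` if `i = i_j`, and by
`0` if `i` is not one of the `i_j`. -/
def annih (i : ι) : Fock ι →L[ℂ] Fock ι :=
  weightedComp (fun A => if i ∈ A then 0 else fermiSign i A) (fun A => insert i A)
    (fun A => by
      by_cases h : i ∈ A
      · simp [h]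
      · simp [h, norm_fermiSign])
    (fun A hA B hB hAB => by
      have hA' : i ∉ A := fun h => hA (by simp [h])
      have hB' : i ∉ B := fun h => hB (by simp [h])
      rw [← Finset.erase_insert hA', ← Finset.erase_insert hB']
      exact congrArg (fun C => C.erase i) hAB)

/-- The creation operator `c*_i = c*(e_i)`, the adjoint of `c_i`. -/
def creat (i : ι) : Fock ι →L[ℂ] Fock ι := star (annih i)

/-- The creation operator `c*(φ) = ∑ φ_i c*_i` (a norm convergent series, see
`summable_creation`), linear in `φ`. -/
def creation (φ : ℓ²(ι, ℂ)) : Fock ι →L[ℂ] Fock ι := ∑' i, φ i • creat i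

/-- The annihilation operator `c(φ)`, the adjoint of `c*(φ)`. -/
def annihilation (φ : ℓ²(ι, ℂ)) : Fock ι →L[ℂ] Fock ι := star (creation φ)

theorem annih_apply (i : ι) (f : Fock ι) (A : Finset ι) :
    annih i f A = (if i ∈ A then 0 else fermiSign i A) * f (insert i A) := rfl

theorem inner_basisVec (A : Finset ι) (f : Fock ι) : ⟪basisVec A, f⟫_ℂ = f A := by
  simp [basisVec, lp.inner_single_left]

theorem basisVec_apply (A B : Finset ι) : basisVec A B = if B = A then 1 else 0 := by
  simp [basisVec, lp.single_apply, Pi.single_apply]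

theorem fermiSign_erase (i : ι) (A : Finset ι) : fermiSign i (A.erase i) = fermiSign i A := by
  unfold fermiSign
  congr 2
  ext k
  simp only [Finset.mem_filter, Finset.mem_erase]
  exact ⟨fun h => ⟨h.1.2, h.2⟩, fun h => ⟨⟨h.2.ne, h.1⟩, h.2⟩⟩

theorem creat_apply (i : ι) (f : Fock ι) (A : Finset ι) :
    creat i f A = (if i ∈ A then fermiSign i A else 0) * f (A.erase i) := by
  have h1 : annih i (basisVec A) =
      (if i ∈ A then fermiSign i A else 0) • basisVec (A.erase i) := by
    ext B
    rw [annih_apply, lp.coeFn_smul, Pi.smul_apply, basisVec_apply, basisVec_apply, smul_eq_mul]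
    by_cases hB : i ∈ B
    · have : B ≠ A.erase i := fun h => by simp [h] at hB
      simp [hB, this]
    · by_cases hBA : B = A.erase i
      · subst hBA
        by_cases hA : i ∈ A
        · simp [hA, Finset.insert_erase hA, fermiSign_erase]
        · have : insert i A ≠ A := fun h => hA (h ▸ Finset.mem_insert_self i A)
          simp [hA, this]
      · have : insert i B ≠ A := fun h => hBA (by rw [← h, Finset.erase_insert hB])
        simp [hBA, this]
  rw [← inner_basisVec A, creat, ContinuousLinearMap.star_eq_adjoint,
    ContinuousLinearMap.adjoint_inner_right, h1, inner_smul_left, inner_basisVec]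
  congr 1
  split_ifs <;> simp [fermiSign]

theorem fermiSign_mul_self (i : ι) (A : Finset ι) : fermiSign i A * fermiSign i A = 1 := by
  rw [fermiSign, ← pow_add, Even.neg_one_pow ⟨_, rfl⟩]

theorem fermiSign_insert (i j : ι) (A : Finset ι) (hj : j ∉ A) :
    fermiSign i (insert j A) = (if j < i then -1 else 1) * fermiSign i A := by
  unfold fermiSign
  rw [Finset.filter_insert]
  split_ifs with h
  · rw [Finset.card_insert_of_notMem (by simp [hj]), pow_succ]
    ring
  · simp

/-- The canonical anticommutation relation `{c_i, c*_j} = δ_ij`. -/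
theorem annih_creat (i j : ι) :
    annih i * creat j + creat j * annih i = if i = j then (1 : Fock ι →L[ℂ] Fock ι) else 0 := by
  ext f A
  have hl : ((annih i * creat j + creat j * annih i) f) A
      = annih i (creat j f) A + creat j (annih i f) A := rfl
  rw [hl, annih_apply, creat_apply, creat_apply, annih_apply]
  by_cases hij : i = j
  · subst hij
    by_cases hi : i ∈ A
    · have := fermiSign_mul_self i A
      simp only [hi, if_true, Finset.notMem_erase, if_false, fermiSign_erase,
        Finset.insert_erase hi, ← mul_assoc, this]
      simp
    · have := fermiSign_mul_self i A
      have h2 : fermiSign i (insert i A) = fermiSign i A := by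
        rw [← fermiSign_erase i (insert i A), Finset.erase_insert hi]
      simp only [hi, if_false, Finset.mem_insert_self, if_true, Finset.erase_insert hi, h2,
        ← mul_assoc, this]
      simp
  · simp only [hij, if_false]
    by_cases hi : i ∈ A
    · simp [hi, hij]
    by_cases hj : j ∈ A
    · have hne : j ≠ i := fun h => hij h.symm
      have h1 : fermiSign j (insert i A) = (if i < j then -1 else 1) * fermiSign j A :=
        fermiSign_insert j i A hi
      have h2 : fermiSign i A = (if j < i then -1 else 1) * fermiSign i (A.erase j) := by
        rw [← fermiSign_insert i j _ (Finset.notMem_erase j A), Finset.insert_erase hj]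
      have h3 : (insert i A).erase j = insert i (A.erase j) :=
        Finset.erase_insert_of_ne hij
      simp only [hi, hj, if_true, if_false, Finset.mem_insert, Finset.mem_erase, or_true,
        and_false, h1, h2, h3]
      rcases lt_or_gt_of_ne hij with h | h
      · simp [h, h.not_gt]
        ring
      · simp [h, h.not_gt]
        ring
    · simp [hi, hj, Ne.symm hij]

theorem norm_sum_creat_sq_le (φ : ι → ℂ) (s : Finset ι) :
    ‖∑ i ∈ s, φ i • creat i‖ ^ 2 ≤ ∑ i ∈ s, ‖φ i‖ ^ 2 := by
  set T : Fock ι →L[ℂ] Fock ι := ∑ i ∈ s, φ i • creat i with hT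
  set c : ℝ := ∑ i ∈ s, ‖φ i‖ ^ 2 with hc
  have hc0 : 0 ≤ c := Finset.sum_nonneg fun i _ => sq_nonneg _
  have hstar : star T = ∑ i ∈ s, star (φ i) • annih i := by
    simp [hT, star_sum, creat]
  have hcar : star T * T + T * star T = (c : ℂ) • (1 : Fock ι →L[ℂ] Fock ι) := by
    rw [hstar, hT, Finset.sum_mul_sum, Finset.sum_mul_sum, Finset.sum_comm (s := s) (t := s)
      (f := fun i j => φ i • creat i * star (φ j) • annih j), ← Finset.sum_add_distrib]
    have : ∀ i ∈ s, (∑ j ∈ s, star (φ i) • annih i * φ j • creat j) +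
        (∑ j ∈ s, φ j • creat j * star (φ i) • annih i) =
        ((‖φ i‖ ^ 2 : ℝ) : ℂ) • (1 : Fock ι →L[ℂ] Fock ι) := by
      intro i hi
      rw [← Finset.sum_add_distrib]
      have h2 : ∀ j ∈ s, star (φ i) • annih i * φ j • creat j +
          φ j • creat j * star (φ i) • annih i =
          if i = j then (star (φ i) * φ j) • (1 : Fock ι →L[ℂ] Fock ι) else 0 := by
        intro j _
        rw [smul_mul_smul_comm, smul_mul_smul_comm, mul_comm (φ j), ← smul_add, annih_creat]
        split_ifs <;> simp
      rw [Finset.sum_congr rfl h2, Finset.sum_ite_eq, if_pos hi]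
      congr 1
      rw [Complex.star_def, Complex.conj_mul']
      push_cast
      rfl
    rw [Finset.sum_congr rfl this, ← Finset.sum_smul, hc]
    push_cast
    rfl
  have hb : ‖T‖ ≤ Real.sqrt c := by
    refine ContinuousLinearMap.opNorm_le_bound _ (Real.sqrt_nonneg _) fun x => ?_
    have h1 := congrArg (fun S : Fock ι →L[ℂ] Fock ι => RCLike.re ⟪x, S x⟫_ℂ) hcar
    have h2 : RCLike.re ⟪x, (star T * T) x⟫_ℂ = ‖T x‖ ^ 2 := by
      rw [mul_apply_eq_comp, ContinuousLinearMap.star_eq_adjoint,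
        ContinuousLinearMap.adjoint_inner_right, inner_self_eq_norm_sq]
    have h3 : RCLike.re ⟪x, (T * star T) x⟫_ℂ = ‖star T x‖ ^ 2 := by
      rw [mul_apply_eq_comp, ← ContinuousLinearMap.adjoint_inner_left,
        ← ContinuousLinearMap.star_eq_adjoint, inner_self_eq_norm_sq]
    have h4 : RCLike.re ⟪x, ((c : ℂ) • (1 : Fock ι →L[ℂ] Fock ι)) x⟫_ℂ = c * ‖x‖ ^ 2 := by
      rw [smul_apply, one_apply_eq_self, inner_smul_right,
        inner_self_eq_norm_sq_to_K]
      exact (congrArg Complex.re (by push_cast; rfl :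
        (c : ℂ) * ((‖x‖ : ℂ)) ^ 2 = ((c * ‖x‖ ^ 2 : ℝ) : ℂ))).trans (Complex.ofReal_re _)
    have h5 : ‖T x‖ ^ 2 + ‖star T x‖ ^ 2 = c * ‖x‖ ^ 2 := by
      rw [← h2, ← h3, ← h4, ← map_add, ← inner_add_right, ← add_apply, hcar]
    have h6 : ‖T x‖ ^ 2 ≤ (Real.sqrt c * ‖x‖) ^ 2 := by
      rw [mul_pow, Real.sq_sqrt hc0, ← h5]
      linarith [sq_nonneg ‖star T x‖]
    exact le_of_sq_le_sq h6 (by positivity)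
  calc ‖T‖ ^ 2 ≤ Real.sqrt c ^ 2 := by gcongr
    _ = c := Real.sq_sqrt hc0

/-- The series defining `c*(φ)` converges in operator norm. -/
theorem summable_creation (φ : ℓ²(ι, ℂ)) : Summable fun i => φ i • creat i := by
  have hs : Summable fun i => ‖φ i‖ ^ 2 := by
    have := (lp.memℓp φ).summable (by norm_num)
    simpa using this
  rw [summable_iff_vanishing_norm]
  intro ε hε
  obtain ⟨s, h⟩ := (summable_iff_vanishing_norm.1 hs) (ε ^ 2) (by positivity)
  refine ⟨s, fun t ht => ?_⟩
  have h1 := norm_sum_creat_sq_le φ t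
  have h2 := lt_of_le_of_lt (le_abs_self _) (h t ht)
  exact lt_of_pow_lt_pow_left₀ 2 hε.le (h1.trans_lt h2)

/-- The sign of the permutation which sorts `(π i₁, …, π i_q)`, where `A = {i₁ < ⋯ < i_q}`. -/
def sortSign (π : Equiv.Perm ι) (A : Finset ι) : ℂ :=
  (-1) ^ ((A ×ˢ A).filter fun x => x.1 < x.2 ∧ π x.2 < π x.1).card

/-- The second quantization `Γ(W)` of the unitary `W e_i = e_{π i}`, i.e.
`Γ(W) (e_{i₁} ∧ ⋯ ∧ e_{i_q}) = e_{π i₁} ∧ ⋯ ∧ e_{π i_q}`, as an operator on Fock space. -/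
def secondQuantOp (π : Equiv.Perm ι) : Fock ι →L[ℂ] Fock ι :=
  weightedComp (fun A => sortSign π (A.map π.symm.toEmbedding)) (fun A => A.map π.symm.toEmbedding)
    (fun A => by simp [sortSign]) (fun A _ B _ h => Finset.map_injective _ h)

theorem fermiSign_eq_prod (i : ι) (A : Finset ι) :
    fermiSign i A = ∏ k ∈ A, if k < i then (-1 : ℂ) else 1 := by
  rw [fermiSign, ← Finset.prod_filter, Finset.prod_const]

theorem sortSign_eq_prod (π : Equiv.Perm ι) (A : Finset ι) :
    sortSign π A = ∏ x ∈ A, ∏ y ∈ A, if x < y ∧ π y < π x then (-1 : ℂ) else 1 := by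
  rw [sortSign, ← Finset.prod_product', ← Finset.prod_filter, Finset.prod_const]

theorem sortSign_mul_self (π : Equiv.Perm ι) (A : Finset ι) : sortSign π A * sortSign π A = 1 := by
  rw [sortSign, ← pow_add, Even.neg_one_pow ⟨_, rfl⟩]

theorem sortSign_insert (π : Equiv.Perm ι) (k : ι) (A : Finset ι) (hk : k ∉ A) :
    sortSign π A * fermiSign (π k) (A.map π.toEmbedding) * sortSign π (insert k A)
      = fermiSign k A := by
  have h1 : sortSign π (insert k A) = sortSign π A *
      ∏ y ∈ A, ((if k < y ∧ π y < π k then (-1 : ℂ) else 1) *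
        (if y < k ∧ π k < π y then (-1 : ℂ) else 1)) := by
    rw [sortSign_eq_prod, sortSign_eq_prod, Finset.prod_insert hk, Finset.prod_insert hk,
      Finset.prod_congr rfl fun x _ => Finset.prod_insert hk, Finset.prod_mul_distrib,
      Finset.prod_mul_distrib]
    simp only [lt_self_iff_false, and_self, if_false]
    ring
  rw [h1, mul_comm (sortSign π A) (fermiSign _ _), mul_assoc, ← mul_assoc (sortSign π A),
    sortSign_mul_self, one_mul, fermiSign_eq_prod, fermiSign_eq_prod, Finset.prod_map,
    ← Finset.prod_mul_distrib]
  refine Finset.prod_congr rfl fun y hy => ?_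
  have hyk : y ≠ k := fun h => hk (h ▸ hy)
  have hne : π y ≠ π k := fun h => hyk (π.injective h)
  simp only [Equiv.coe_toEmbedding]
  rcases lt_or_gt_of_ne hyk with h | h <;> rcases lt_or_gt_of_ne hne with h' | h' <;>
    simp [h, h', h.not_gt, h'.not_gt]

theorem secondQuantOp_apply (π : Equiv.Perm ι) (f : Fock ι) (A : Finset ι) :
    secondQuantOp π f A =
      sortSign π (A.map π.symm.toEmbedding) * f (A.map π.symm.toEmbedding) := rfl

theorem map_symm_map {κ : Type*} (π : Equiv.Perm κ) (A : Finset κ) :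
    (A.map π.toEmbedding).map π.symm.toEmbedding = A := by
  ext x
  simp

theorem map_map_symm {κ : Type*} (π : Equiv.Perm κ) (A : Finset κ) :
    (A.map π.symm.toEmbedding).map π.toEmbedding = A := by
  ext x
  simp

theorem star_secondQuantOp_apply (π : Equiv.Perm ι) (f : Fock ι) (A : Finset ι) :
    star (secondQuantOp π) f A = sortSign π A * f (A.map π.toEmbedding) := by
  have h1 : secondQuantOp π (basisVec A) = sortSign π A • basisVec (A.map π.toEmbedding) := by
    ext B
    rw [secondQuantOp_apply, lp.coeFn_smul, Pi.smul_apply, basisVec_apply, basisVec_apply,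
      smul_eq_mul]
    by_cases hB : B = A.map π.toEmbedding
    · subst hB
      simp only [map_symm_map, if_true]
    · have : B.map π.symm.toEmbedding ≠ A := fun h => hB (by rw [← h, map_map_symm])
      simp [hB, this]
  rw [← inner_basisVec A, ContinuousLinearMap.star_eq_adjoint,
    ContinuousLinearMap.adjoint_inner_right, h1, inner_smul_left, inner_basisVec]
  congr 1
  simp [sortSign]

/-- The second quantization `Γ(W)` of `W e_i = e_{π i}`, as a unitary operator. -/
def secondQuant (π : Equiv.Perm ι) : unitary (Fock ι →L[ℂ] Fock ι) :=
  ⟨secondQuantOp π, by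
    rw [Unitary.mem_iff]
    constructor
    · ext f A
      have : (star (secondQuantOp π) * secondQuantOp π) f A =
        star (secondQuantOp π) (secondQuantOp π f) A := rfl
      rw [this, star_secondQuantOp_apply, secondQuantOp_apply, map_symm_map, ← mul_assoc,
        sortSign_mul_self, one_mul]
      rfl
    · ext f A
      have : (secondQuantOp π * star (secondQuantOp π)) f A =
        secondQuantOp π (star (secondQuantOp π) f) A := rfl
      rw [this, secondQuantOp_apply, star_secondQuantOp_apply, map_map_symm, ← mul_assoc,
        sortSign_mul_self, one_mul]
      rfl⟩

/-- `Γ(W)* c*_i Γ(W) = c*(W* e_i)`. -/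
theorem secondQuant_conj_creat (π : Equiv.Perm ι) (i : ι) :
    star (secondQuantOp π) * creat i * secondQuantOp π = creat (π.symm i) := by
  have h : star (secondQuantOp π) * annih i * secondQuantOp π = annih (π.symm i) := by
    ext f A
    have h0 : (star (secondQuantOp π) * annih i * secondQuantOp π) f A =
      star (secondQuantOp π) (annih i (secondQuantOp π f)) A := rfl
    obtain ⟨k, rfl⟩ := π.surjective i
    rw [h0, star_secondQuantOp_apply, annih_apply, secondQuantOp_apply, annih_apply,
      Finset.map_insert, map_symm_map, Equiv.symm_apply_apply]
    simp only [Equiv.coe_toEmbedding, Equiv.symm_apply_apply, Finset.mem_map_equiv]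
    by_cases hk : k ∈ A
    · simp [hk]
    · simp only [hk, if_false, ← mul_assoc]
      rw [sortSign_insert π k A hk]
  have h2 := congrArg star h
  simpa [creat, mul_assoc] using h2

/-! ### The reservoir algebra -/

/-- The `C*`-algebra generated by all `c*(φ)`, `c(φ)`, `φ ∈ ℓ²(ι)`. -/
def CAR (ι : Type*) [LinearOrder ι] : StarSubalgebra ℂ (Fock ι →L[ℂ] Fock ι) :=
  (StarAlgebra.adjoin ℂ (Set.range (creation (ι := ι)) ∪ Set.range annihilation)).topologicalClosure

theorem isClosed_CAR : IsClosed (CAR ι : Set (Fock ι →L[ℂ] Fock ι)) :=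
  StarSubalgebra.isClosed_topologicalClosure _

theorem creation_mem (φ : ℓ²(ι, ℂ)) : creation φ ∈ CAR ι :=
  StarSubalgebra.le_topologicalClosure _ (StarAlgebra.subset_adjoin _ _ (Or.inl ⟨φ, rfl⟩))

theorem annihilation_mem (φ : ℓ²(ι, ℂ)) : annihilation φ ∈ CAR ι := star_mem (creation_mem φ)

/-- `c*(φ)` as an element of the algebra generated by the creation and annihilation operators. -/
def CAR.creation (φ : ℓ²(ι, ℂ)) : CAR ι := ⟨FermionWalk.creation φ, creation_mem φ⟩

/-- `c(φ)` as an element of the algebra generated by the creation and annihilation operators. -/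
def CAR.annihilation (φ : ℓ²(ι, ℂ)) : CAR ι := ⟨FermionWalk.annihilation φ, annihilation_mem φ⟩

theorem creation_single (i : ι) : creation (lp.single 2 i (1 : ℂ)) = creat i := by
  rw [creation, tsum_eq_single i]
  · simp
  · intro j hj
    simp [lp.single_apply, hj]

theorem creat_mem (i : ι) : creat i ∈ CAR ι := creation_single i ▸ creation_mem _

theorem secondQuant_conj_mem (π : Equiv.Perm ι) {x : Fock ι →L[ℂ] Fock ι} (hx : x ∈ CAR ι) :
    Unitary.conjStarAlgAut ℂ _ (star (secondQuant π)) x ∈ CAR ι := by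
  set F := Unitary.conjStarAlgAut ℂ (Fock ι →L[ℂ] Fock ι) (star (secondQuant π)) with hF
  have hFx : ∀ y, F y = star (secondQuantOp π) * y * secondQuantOp π := fun y =>
    Unitary.conjStarAlgAut_star_apply _ _
  have hcont : Continuous F := by
    have : (F : (Fock ι →L[ℂ] Fock ι) → _) = fun y =>
      star (secondQuantOp π) * y * secondQuantOp π := funext hFx
    rw [this]
    fun_prop
  have hc : ∀ φ : ℓ²(ι, ℂ), F (creation φ) ∈ CAR ι := by
    intro φ
    have h1 : F (creation φ) = ∑' i, φ i • creat (π.symm i) := by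
      rw [hFx, creation, ← (summable_creation φ).tsum_mul_left,
        ← ((summable_creation φ).mul_left _).tsum_mul_right]
      refine tsum_congr fun i => ?_
      rw [mul_smul_comm, smul_mul_assoc, secondQuant_conj_creat]
    rw [h1]
    by_cases hs : Summable fun i => φ i • creat (π.symm i)
    · refine isClosed_CAR.mem_of_tendsto hs.hasSum (Eventually.of_forall fun s => ?_)
      exact sum_mem fun i _ => SMulMemClass.smul_mem _ (creat_mem _)
    · rw [tsum_eq_zero_of_not_summable hs]
      exact zero_mem _
  have hsub : CAR ι ≤ (CAR ι).comap (F : (Fock ι →L[ℂ] Fock ι) →⋆ₐ[ℂ] (Fock ι →L[ℂ] Fock ι)) := by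
    refine StarSubalgebra.topologicalClosure_minimal ?_ (isClosed_CAR.preimage hcont)
    refine StarAlgebra.adjoin_le ?_
    rintro y (⟨φ, rfl⟩ | ⟨φ, rfl⟩)
    · exact hc φ
    · change F (star (creation φ)) ∈ CAR ι
      rw [map_star]
      exact star_mem (hc φ)
  exact hsub hx

/-- The free evolution `A ↦ Γ(W)* A Γ(W)`, `W e_i = e_{π i}`, on the algebra generated by the
creation and annihilation operators. -/
def freeEvolution (π : Equiv.Perm ι) (A : CAR ι) : CAR ι :=
  ⟨Unitary.conjStarAlgAut ℂ _ (star (secondQuant π)) A, secondQuant_conj_mem π A.2⟩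

/-- A state on the algebra generated by the creation and annihilation operators: a positive
normalized bounded linear functional. -/
structure IsState (ω : CAR ι →L[ℂ] ℂ) : Prop where
  nonneg : ∀ A, 0 ≤ ω (star A * A)
  map_one : ω 1 = 1

/-- `ω` is the gauge invariant quasi-free functional with density `Σ`:
`ω(c*(φ_m) ⋯ c*(φ_1) c(ψ_1) ⋯ c(ψ_n)) = δ_{nm} det (⟨ψ_j, Σ φ_k⟩)`. -/
def IsQuasiFree (ω : CAR ι →L[ℂ] ℂ) (Sig : ℓ²(ι, ℂ) →L[ℂ] ℓ²(ι, ℂ)) : Prop :=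
  ∀ (m n : ℕ) (φ : Fin m → ℓ²(ι, ℂ)) (ψ : Fin n → ℓ²(ι, ℂ)),
    ω ((List.ofFn fun k => CAR.creation (φ k)).reverse.prod *
        (List.ofFn fun j => CAR.annihilation (ψ j)).prod) =
      if h : n = m then Matrix.det (Matrix.of fun j k : Fin n => ⟪ψ j, Sig (φ (Fin.cast h k))⟫_ℂ)
      else 0

end Fock

/-! ### The sample -/

section Sample

variable {d : ℕ}

/-- The operators on the Fock space of the sample `ℓ²({0, …, d-1})`. -/
abbrev SampleOp (d : ℕ) : Type := Fock (Fin d) →L[ℂ] Fock (Fin d)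

instance : FiniteDimensional ℂ (Fock (Fin d)) :=
  (lpPiLpₗᵢ (p := 2) (fun _ : Finset (Fin d) => ℂ) ℂ).toLinearEquiv.symm.finiteDimensional

/-- The trace over the Fock space of the sample. -/
def tr (A : SampleOp d) : ℂ := LinearMap.trace ℂ (Fock (Fin d)) A

/-- Density matrices: positive operators of trace one. -/
structure IsDensityMatrix (ρ : SampleOp d) : Prop where
  isPositive : ρ.IsPositive
  tr_eq_one : tr ρ = 1

/-- The number operator `N_s = ∑ a*_i a_i`. -/
def numberOp (d : ℕ) : SampleOp d := ∑ i, creat i * annih i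

/-- The orthogonal projection onto the eigenspace of `N_s` for the eigenvalue `p`. -/
def numberProj (d p : ℕ) : SampleOp d :=
  (Module.End.eigenspace (numberOp d : Module.End ℂ (Fock (Fin d))) (p : ℂ)).starProjection

/-- `Z(μ) = tr e^{-μ N_s}`. -/
def partitionFn (d : ℕ) (μ : ℝ) : ℂ := tr (NormedSpace.exp (-(μ : ℂ) • numberOp d))

/-- The Gibbs density matrix `e^{-μ N_s} / Z(μ)`. -/
def gibbs (d : ℕ) (μ : ℝ) : SampleOp d :=
  (partitionFn d μ)⁻¹ • NormedSpace.exp (-(μ : ℂ) • numberOp d)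

/-- `a*_{k₁} ⋯ a*_{k_p}` for `K = {k₁ < ⋯ < k_p}`. -/
def creatProd (K : Finset (Fin d)) : SampleOp d := ((K.sort (· ≤ ·)).map creat).prod

/-- The `p`-body reduced density matrix, on the `p`-th antisymmetric power of `ℓ²({0, …, d-1})`, of
the state `A ↦ s A` of the sample.  Its matrix element between `e_{j₁} ∧ ⋯ ∧ e_{j_p}` and
`e_{k₁} ∧ ⋯ ∧ e_{k_p}` is `s(a*_{k₁} ⋯ a*_{k_p} a_{j_p} ⋯ a_{j₁})`. -/
def reducedDensityMatrix (p : ℕ) (s : SampleOp d → ℂ) :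
    Matrix {J : Finset (Fin d) // J.card = p} {J : Finset (Fin d) // J.card = p} ℂ :=
  Matrix.of fun J K => s (creatProd K.1 * star (creatProd J.1))

end Sample

/-! ### The coupled dynamics -/

section Dynamics

variable {d : ℕ}

/-- The algebra `ℬ ⊗ 𝒜` of the composite system, `ℬ` the algebra of the reservoir (over `ℓ²(ℤ)`) and
`𝒜` the algebra of all operators on the `2^d`-dimensional Fock space of the sample: the matrices
over `ℬ` indexed by the basis of the latter (the `C*`-norm topology is the entrywise one). -/
abbrev CompositeAlg (d : ℕ) : Type := Matrix (Finset (Fin d)) (Finset (Fin d)) (CAR ℤ)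

/-- The elementary tensor `B ⊗ A`. -/
def tensor (B : CAR ℤ) (A : SampleOp d) : CompositeAlg d :=
  Matrix.of fun S T => ⟪basisVec S, A (basisVec T)⟫_ℂ • B

/-- The creation operator `b*_j` of the reservoir. -/
def bStar (j : ℤ) : CAR ℤ := CAR.creation (lp.single 2 j 1)

/-- The annihilation operator `b_j` of the reservoir. -/
def bAnn (j : ℤ) : CAR ℤ := CAR.annihilation (lp.single 2 j 1)

/-- The coupling `K = exp[-iα (b*_0 ⊗ a_0 + b_0 ⊗ a*_0)]`. -/
def coupling (d : ℕ) [NeZero d] (α : ℝ) : CompositeAlg d :=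
  NormedSpace.exp ((-(Complex.I * α)) •
    (tensor (bStar 0) (annih (0 : Fin d)) + tensor (bAnn 0) (creat (0 : Fin d))))

/-- The shift `Ψ_j ↦ Ψ_{j-1}` in the reservoir. -/
def reservoirShift : Equiv.Perm ℤ := Equiv.subRight 1

/-- The periodic shift `e_j ↦ e_{j-1}`, `e_0 ↦ e_{d-1}`, in the sample. -/
def sampleShift (d : ℕ) [NeZero d] : Equiv.Perm (Fin d) := Equiv.subRight 1

/-- The free evolution `τ_r ⊗ τ_s`, `τ_r = Γ(S)* · Γ(S)`, `τ_s = Γ(S_p)* · Γ(S_p)`. -/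
def freeStep [NeZero d] (X : CompositeAlg d) : CompositeAlg d :=
  star (tensor 1 (secondQuant (sampleShift d) : SampleOp d)) *
    X.map (freeEvolution reservoirShift) *
    tensor 1 (secondQuant (sampleShift d) : SampleOp d)

/-- One step of the evolution of observables, `τ(X) = U* X U` with `U = (Γ(S) ⊗ Γ(S_p)) K`. -/
def step [NeZero d] (α : ℝ) (X : CompositeAlg d) : CompositeAlg d :=
  star (coupling d α) * freeStep X * coupling d α

/-- The product functional `ω ⊗ ρ`, with `(ω ⊗ ρ)(B ⊗ A) = ω(B) tr(ρ A)`. -/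
def productState (ω : CAR ℤ →L[ℂ] ℂ) (ρ : SampleOp d) (X : CompositeAlg d) : ℂ :=
  ∑ S, ∑ T, ⟪basisVec T, ρ (basisVec S)⟫_ℂ * ω (X S T)

/-- The state of the sample at time `t`, `ρ_t(A) = (ω ⊗ ρ)(τ^t(1 ⊗ A))`. -/
def sampleState [NeZero d] (α : ℝ) (ω : CAR ℤ →L[ℂ] ℂ) (ρ : SampleOp d) (t : ℕ)
    (A : SampleOp d) : ℂ :=
  productState ω ρ ((step α)^[t] (tensor 1 A))

end Dynamics

end FermionWalk

end

noncomputable section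

namespace FermionWalk

/-! ### Instance shortcuts for the reservoir algebra -/

-- The proof shows that the sample sees a fresh reservoir mode at every step, so that its reduced
-- evolution is the iteration of one explicit map, and then diagonalizes this map site by site.
--
-- Markov property. In the Heisenberg picture one step is `K* (free step) K`. The free step sends
-- `b_j` to `b_{j+1}`, so an observable supported on the modes `j ≥ 0` is moved to the modes `j ≥
-- 1`, while `K` contains only the mode `0`. Because the density is a multiple of the identity, the
-- determinant formula makes `ω` factorize between the mode `0` and the modes `j ≥ 1`
-- (`quasiFree_sandwich`) and makes it shift invariant (`quasiFree_freeEvolutionHom`). The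
-- anticommutation signs do no harm: a monomial with equally many creators and annihilators is even,
-- and `ω` vanishes on all other normally ordered monomials. Hence applying `ω` entrywise turns
-- `step` into `reducedStep` (`map_step`): the sample shift followed by the map `siteMap` at site
-- `0`.
--
-- Unfolding. The shift intertwines the site maps of neighbouring sites, so all shifts can be moved
-- inside. After `m * d` steps each site map has been applied exactly `m` times
-- (`reducedStep_iterate`, `count_range_map_ofNat`).
--
-- Mixing. In the occupation basis `siteMap` multiplies by `cos α` every matrix element whose two
-- indices differ at the site. On diagonal elements it is a two-state Markov chain that fixes
-- constants and multiplies `1_{j ∈ S} - σ` by `cos² α`. As `|cos α| < 1`, the evolved observable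
-- tends to a multiple of the identity, the factor being its expectation when sites are
-- independently occupied with probability `σ` (`tendsto_reducedStep`). Only `tr ρ = 1` is then
-- needed from the initial state. The three claims are evaluations of this product expectation: on
-- products of creators and annihilators, as a Gibbs trace, and on the spectral projections of the
-- particle number.

scoped instance instRingReservoir : Ring (CAR ℤ) := inferInstance
scoped instance instAlgebraReservoir : Algebra ℂ (CAR ℤ) := inferInstance
scoped instance instMulReservoir : Mul (CAR ℤ) := inferInstance
scoped instance instOneReservoir : One (CAR ℤ) := inferInstance
scoped instance instZeroReservoir : Zero (CAR ℤ) := inferInstance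
scoped instance instAddReservoir : Add (CAR ℤ) := inferInstance
scoped instance instSemiringReservoir : Semiring (CAR ℤ) := inferInstance
scoped instance instMonoidReservoir : Monoid (CAR ℤ) := inferInstance
scoped instance instAddCommMonoidReservoir : AddCommMonoid (CAR ℤ) := inferInstance
scoped instance instAddCommGroupReservoir : AddCommGroup (CAR ℤ) := inferInstance
scoped instance instModuleReservoir : Module ℂ (CAR ℤ) := inferInstance
scoped instance instSMulReservoir : SMul ℂ (CAR ℤ) := inferInstance
scoped instance instScalarTowerReservoir : IsScalarTower ℂ (CAR ℤ) (CAR ℤ) := inferInstance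
scoped instance instSMulCommReservoir : SMulCommClass ℂ (CAR ℤ) (CAR ℤ) := inferInstance
scoped instance instTopologicalSpaceReservoir : TopologicalSpace (CAR ℤ) := inferInstance

/-! ### Anticommutation relations -/

section Relations

variable {ι : Type*} [LinearOrder ι]

theorem annih_annih (i j : ι) : annih i * annih j + annih j * annih i = 0 := by
  ext f A
  have hl : ((annih i * annih j + annih j * annih i) f) A
      = annih i (annih j f) A + annih j (annih i f) A := rfl
  rw [hl, annih_apply, annih_apply, annih_apply, annih_apply]
  by_cases hi : i ∈ A
  · simp [hi]
  by_cases hj : j ∈ A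
  · simp [hj]
  by_cases hij : i = j
  · subst hij
    simp
  have h1 := fermiSign_insert j i A hi
  have h2 := fermiSign_insert i j A hj
  simp only [hi, hj, Finset.mem_insert, hij, Ne.symm hij, or_self, if_false, h1, h2,
    Finset.insert_comm j i A]
  rcases lt_or_gt_of_ne hij with h | h
  · simp [h, h.not_gt]
    ring
  · simp [h, h.not_gt]
    ring

theorem annih_mul_self (i : ι) : annih i * annih i = 0 := by
  have h := annih_annih i i
  rw [← two_smul ℂ] at h
  exact (smul_eq_zero.1 h).resolve_left two_ne_zero

theorem creat_creat (i j : ι) : creat i * creat j + creat j * creat i = 0 := by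
  have := congrArg star (annih_annih j i)
  simpa [creat] using this

end Relations

theorem coe_bStar (j : ℤ) : (bStar j : Fock ℤ →L[ℂ] Fock ℤ) = creat j := creation_single j

theorem coe_bAnn (j : ℤ) : (bAnn j : Fock ℤ →L[ℂ] Fock ℤ) = annih j := by
  change star (creation _) = _
  rw [creation_single, creat, star_star]

theorem star_bStar (j : ℤ) : star (bStar j) = bAnn j := rfl

theorem star_bAnn (j : ℤ) : star (bAnn j) = bStar j := by rw [← star_bStar, star_star]

theorem bAnn_bStar (i j : ℤ) :
    bAnn i * bStar j + bStar j * bAnn i = if i = j then 1 else 0 := by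
  apply Subtype.ext
  have := annih_creat i j
  rw [← coe_bAnn, ← coe_bStar] at this
  split_ifs at this ⊢ <;> exact this

theorem bAnn_bAnn (i j : ℤ) : bAnn i * bAnn j + bAnn j * bAnn i = 0 := by
  apply Subtype.ext
  have := annih_annih i j
  rwa [← coe_bAnn, ← coe_bAnn] at this

theorem bStar_bStar (i j : ℤ) : bStar i * bStar j + bStar j * bStar i = 0 := by
  apply Subtype.ext
  have := creat_creat i j
  rwa [← coe_bStar, ← coe_bStar] at this

theorem bAnn_mul_self (i : ℤ) : bAnn i * bAnn i = 0 := by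
  apply Subtype.ext
  have := annih_mul_self i
  rwa [← coe_bAnn] at this

theorem bStar_mul_self (i : ℤ) : bStar i * bStar i = 0 := by
  have := congrArg star (bAnn_mul_self i)
  rwa [star_mul, star_bAnn, star_zero] at this

theorem bAnn_mul_bStar_self (i : ℤ) : bAnn i * bStar i = 1 - bStar i * bAnn i := by
  rw [eq_sub_iff_add_eq, bAnn_bStar, if_pos rfl]

/-! ### The algebra of the modes `j ≥ k` -/

/-- The algebra generated by `b_j, b*_j`, `j ≥ k`. -/
def modesGE (k : ℤ) : Subalgebra ℂ (CAR ℤ) :=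
  Algebra.adjoin ℂ (bStar '' Set.Ici k ∪ bAnn '' Set.Ici k)

theorem bStar_mem_modesGE {j k : ℤ} (h : k ≤ j) : bStar j ∈ modesGE k :=
  Algebra.subset_adjoin (Or.inl ⟨j, h, rfl⟩)

theorem bAnn_mem_modesGE {j k : ℤ} (h : k ≤ j) : bAnn j ∈ modesGE k :=
  Algebra.subset_adjoin (Or.inr ⟨j, h, rfl⟩)

theorem modesGE_anti {j k : ℤ} (h : k ≤ j) : modesGE j ≤ modesGE k := by
  apply Algebra.adjoin_mono
  have := Set.Ici_subset_Ici.2 h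
  gcongr

/-- The normally ordered monomial `b*_{i_m} ⋯ b*_{i_1} b_{j_1} ⋯ b_{j_n}`. -/
def normalMonomial (l l' : List ℤ) : CAR ℤ := (l.map bStar).reverse.prod * (l'.map bAnn).prod

/-- The normally ordered monomials in the modes `j ≥ k`. -/
def normalMonomials (k : ℤ) : Set (CAR ℤ) :=
  {x | ∃ l l' : List ℤ, (∀ i ∈ l, k ≤ i) ∧ (∀ i ∈ l', k ≤ i) ∧ normalMonomial l l' = x}

theorem bStar_mul_mem_span {j k : ℤ} (hj : k ≤ j) {x : CAR ℤ}
    (hx : x ∈ Submodule.span ℂ (normalMonomials k)) :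
    bStar j * x ∈ Submodule.span ℂ (normalMonomials k) := by
  induction hx using Submodule.span_induction with
  | mem x h =>
    obtain ⟨l, l', hl, hl', rfl⟩ := h
    refine Submodule.subset_span ⟨l ++ [j], l', ?_, hl', ?_⟩
    · intro i hi
      rcases List.mem_append.1 hi with h | h
      · exact hl i h
      · rw [List.mem_singleton.1 h]
        exact hj
    · simp [normalMonomial, mul_assoc]
  | zero => simp
  | add x y _ _ hx hy => rw [mul_add]; exact add_mem hx hy
  | smul c x _ hx => rw [mul_smul_comm]; exact Submodule.smul_mem _ _ hx

/-- The annihilator is commuted to the right past the creators one by one; each exchange costs a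
sign and possibly a contraction, and both resulting terms remain normally ordered. -/
theorem bAnn_mul_mem_span {j k : ℤ} (hj : k ≤ j) {x : CAR ℤ}
    (hx : x ∈ Submodule.span ℂ (normalMonomials k)) :
    bAnn j * x ∈ Submodule.span ℂ (normalMonomials k) := by
  induction hx using Submodule.span_induction with
  | mem x h =>
    obtain ⟨l, l', hl, hl', rfl⟩ := h
    -- `normalMonomial` reverses its first list, so the last entry of `l` is the leftmost creator,
    -- the one that `bAnn j` meets first.
    induction l using List.reverseRecOn with
    | nil =>
      refine Submodule.subset_span ⟨[], j :: l', by simp, ?_, ?_⟩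
      · simpa [hj] using hl'
      · simp [normalMonomial]
    | append_singleton l i ih =>
      have h1 : normalMonomial (l ++ [i]) l' = bStar i * normalMonomial l l' := by
        simp [normalMonomial, mul_assoc]
      have hl2 : ∀ a ∈ l, k ≤ a := fun a ha => hl a (by simp [ha])
      rw [h1, ← mul_assoc, eq_sub_of_add_eq (bAnn_bStar j i), sub_mul, mul_assoc]
      refine sub_mem ?_ (bStar_mul_mem_span (hl i (by simp)) (ih hl2))
      split_ifs
      · rw [one_mul]
        exact Submodule.subset_span ⟨l, l', hl2, hl', rfl⟩
      · simp
  | zero => simp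
  | add x y _ _ hx hy => rw [mul_add]; exact add_mem hx hy
  | smul c x _ hx => rw [mul_smul_comm]; exact Submodule.smul_mem _ _ hx

/-- Wick ordering: the quasi-free formula prescribes `ω` on normally ordered products only, so every
later identity for `ω` is checked on these and extended by linearity. -/
theorem modesGE_le_span (k : ℤ) {x : CAR ℤ} (hx : x ∈ modesGE k) :
    x ∈ Submodule.span ℂ (normalMonomials k) := by
  -- Stability of the span under left multiplication by `x` is the form that passes through products
  -- of generators.
  suffices h : ∀ y ∈ Submodule.span ℂ (normalMonomials k),
      x * y ∈ Submodule.span ℂ (normalMonomials k) by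
    simpa using h 1 (Submodule.subset_span ⟨[], [], by simp, by simp, by simp [normalMonomial]⟩)
  induction hx using Algebra.adjoin_induction with
  | mem x h =>
    rcases h with ⟨j, hj, rfl⟩ | ⟨j, hj, rfl⟩
    · exact fun y hy => bStar_mul_mem_span hj hy
    · exact fun y hy => bAnn_mul_mem_span hj hy
  | algebraMap c =>
    intro y hy
    rw [← Algebra.smul_def]
    exact Submodule.smul_mem _ _ hy
  | add x y _ _ hx hy => intro z hz; rw [add_mul]; exact add_mem (hx z hz) (hy z hz)
  | mul x y _ _ hx hy => intro z hz; rw [mul_assoc]; exact hx _ (hy z hz)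

/-! ### The mode `0` -/

/-- The algebra generated by `b_0, b*_0`. -/
def modeZero : Subalgebra ℂ (CAR ℤ) := Algebra.adjoin ℂ {bStar 0, bAnn 0}

theorem bStar_mem_modeZero : bStar 0 ∈ modeZero := Algebra.subset_adjoin (by simp)

theorem bAnn_mem_modeZero : bAnn 0 ∈ modeZero := Algebra.subset_adjoin (by simp)

theorem modeZero_le : modeZero ≤ modesGE 0 := by
  refine Algebra.adjoin_le ?_
  rintro x (rfl | rfl)
  · exact bStar_mem_modesGE le_rfl
  · exact bAnn_mem_modesGE le_rfl

theorem modeZero_le_span {x : CAR ℤ} (hx : x ∈ modeZero) :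
    x ∈ Submodule.span ℂ {1, bStar 0, bAnn 0, bStar 0 * bAnn 0} := by
  set N := Submodule.span ℂ ({1, bStar 0, bAnn 0, bStar 0 * bAnn 0} : Set (CAR ℤ)) with hN
  have m1 : 1 ∈ N := Submodule.subset_span (by simp)
  have m2 : bStar 0 ∈ N := Submodule.subset_span (by simp)
  have m3 : bAnn 0 ∈ N := Submodule.subset_span (by simp)
  have m4 : bStar 0 * bAnn 0 ∈ N := Submodule.subset_span (by simp)
  suffices h : ∀ y ∈ N, x * y ∈ N by simpa using h 1 m1
  induction hx using Algebra.adjoin_induction with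
  | mem x h =>
    intro y hy
    induction hy using Submodule.span_induction with
    | mem y hy =>
      rcases h with rfl | rfl <;> rcases hy with rfl | rfl | rfl | rfl
      · simpa using m2
      · simp [bStar_mul_self]
      · exact m4
      · simp [← mul_assoc, bStar_mul_self]
      · simpa using m3
      · rw [bAnn_mul_bStar_self]
        exact sub_mem m1 m4
      · simp [bAnn_mul_self]
      · rw [← mul_assoc, bAnn_mul_bStar_self, sub_mul, mul_assoc, bAnn_mul_self]
        simpa using m3
    | zero => simp
    | add x y _ _ hx hy => rw [mul_add]; exact add_mem hx hy
    | smul c x _ hx => rw [mul_smul_comm]; exact Submodule.smul_mem _ _ hx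
  | algebraMap c =>
    intro y hy
    rw [← Algebra.smul_def]
    exact Submodule.smul_mem _ _ hy
  | add x y _ _ hx hy => intro z hz; rw [add_mul]; exact add_mem (hx z hz) (hy z hz)
  | mul x y _ _ hx hy => intro z hz; rw [mul_assoc]; exact hx _ (hy z hz)

theorem mul_list_prod_of_anticomm {R : Type*} [Ring R] [Algebra ℂ R] (w : R) (L : List R)
    (h : ∀ x ∈ L, w * x = -(x * w)) : w * L.prod = (-1 : ℂ) ^ L.length • (L.prod * w) := by
  induction L with
  | nil => simp
  | cons x L ih =>
    rw [List.prod_cons, ← mul_assoc, h x (by simp), neg_mul, mul_assoc,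
      ih fun y hy => h y (by simp [hy]), List.length_cons, pow_succ, mul_smul_comm, mul_assoc,
      mul_neg_one, neg_smul]

theorem bStar_zero_anticomm_bStar {j : ℤ} : bStar 0 * bStar j = -(bStar j * bStar 0) :=
  eq_neg_of_add_eq_zero_left (bStar_bStar _ _)

theorem bAnn_zero_anticomm_bAnn {j : ℤ} : bAnn 0 * bAnn j = -(bAnn j * bAnn 0) :=
  eq_neg_of_add_eq_zero_left (bAnn_bAnn _ _)

theorem bStar_zero_anticomm_bAnn {j : ℤ} (hj : 1 ≤ j) :
    bStar 0 * bAnn j = -(bAnn j * bStar 0) := by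
  refine eq_neg_of_add_eq_zero_right ?_
  rw [bAnn_bStar, if_neg (by omega)]

theorem bAnn_zero_anticomm_bStar {j : ℤ} (hj : 1 ≤ j) :
    bAnn 0 * bStar j = -(bStar j * bAnn 0) := by
  refine eq_neg_of_add_eq_zero_left ?_
  rw [bAnn_bStar, if_neg (by omega)]

theorem mul_bStar_prod {w : CAR ℤ} (hw : w = bStar 0 ∨ w = bAnn 0) {l : List ℤ}
    (hl : ∀ i ∈ l, 1 ≤ i) :
    w * (l.map bStar).reverse.prod = (-1 : ℂ) ^ l.length • ((l.map bStar).reverse.prod * w) := by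
  rw [mul_list_prod_of_anticomm]
  · simp
  · intro x hx
    simp only [List.mem_reverse, List.mem_map] at hx
    obtain ⟨j, hj, rfl⟩ := hx
    rcases hw with rfl | rfl
    · exact bStar_zero_anticomm_bStar
    · exact bAnn_zero_anticomm_bStar (hl j hj)

theorem mul_bAnn_prod {w : CAR ℤ} (hw : w = bStar 0 ∨ w = bAnn 0) {l : List ℤ}
    (hl : ∀ i ∈ l, 1 ≤ i) :
    w * (l.map bAnn).prod = (-1 : ℂ) ^ l.length • ((l.map bAnn).prod * w) := by
  rw [mul_list_prod_of_anticomm]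
  · simp
  · intro x hx
    simp only [List.mem_map] at hx
    obtain ⟨j, hj, rfl⟩ := hx
    rcases hw with rfl | rfl
    · exact bStar_zero_anticomm_bAnn (hl j hj)
    · exact bAnn_zero_anticomm_bAnn

theorem mul_normalMonomial {w : CAR ℤ} (hw : w = bStar 0 ∨ w = bAnn 0) {l l' : List ℤ}
    (hl : ∀ i ∈ l, 1 ≤ i) (hl' : ∀ i ∈ l', 1 ≤ i) :
    w * normalMonomial l l' = (-1 : ℂ) ^ (l.length + l'.length) • (normalMonomial l l' * w) := by
  rw [normalMonomial, ← mul_assoc, mul_bStar_prod hw hl, smul_mul_assoc, mul_assoc,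
    mul_bAnn_prod hw hl', pow_add, mul_smul, mul_smul_comm, mul_assoc]

/-- Each generator of the mode `0` anticommutes with every factor of the monomial, so passing
through acts by the parity automorphism or by the identity. For lists of equal length the number of
factors is even and nothing changes; in the other case `ω` of the monomial is zero, so the exact
form of `x'` is irrelevant. -/
theorem modeZero_mul_normalMonomial {l l' : List ℤ}
    (hl : ∀ i ∈ l, 1 ≤ i) (hl' : ∀ i ∈ l', 1 ≤ i) {x : CAR ℤ} (hx : x ∈ modeZero) :
    ∃ x' ∈ modeZero, x * normalMonomial l l' = normalMonomial l l' * x' ∧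
      (l.length = l'.length → x' = x) := by
  induction hx using Algebra.adjoin_induction with
  | mem x h =>
    have hx : x ∈ modeZero := Algebra.subset_adjoin h
    refine ⟨(-1 : ℂ) ^ (l.length + l'.length) • x, Subalgebra.smul_mem _ hx _, ?_, ?_⟩
    · rw [mul_normalMonomial h hl hl', mul_smul_comm]
    · intro h
      rw [h, Even.neg_one_pow ⟨_, rfl⟩, one_smul]
  | algebraMap c => exact ⟨_, Subalgebra.algebraMap_mem _ c, Algebra.commutes c _, fun _ => rfl⟩
  | add x y _ _ hx hy =>
    obtain ⟨x', hx', h1, h1'⟩ := hx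
    obtain ⟨y', hy', h2, h2'⟩ := hy
    exact ⟨x' + y', add_mem hx' hy', by rw [add_mul, mul_add, h1, h2],
      fun h => by rw [h1' h, h2' h]⟩
  | mul x y _ _ hx hy =>
    obtain ⟨x', hx', h1, h1'⟩ := hx
    obtain ⟨y', hy', h2, h2'⟩ := hy
    exact ⟨x' * y', mul_mem hx' hy', by rw [mul_assoc, h2, ← mul_assoc, h1, mul_assoc],
      fun h => by rw [h1' h, h2' h]⟩

/-! ### The quasi-free state with constant density -/

section QuasiFree

variable {σ : ℝ} {ω : CAR ℤ →L[ℂ] ℂ}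

theorem quasiFree_normalMonomial
    (hqf : IsQuasiFree ω ((σ : ℂ) • ContinuousLinearMap.id ℂ ℓ²(ℤ, ℂ))) (l l' : List ℤ) :
    ω (normalMonomial l l') = if h : l'.length = l.length then
      Matrix.det (Matrix.of fun j k : Fin l'.length =>
        if l'.get j = l.get (Fin.cast h k) then (σ : ℂ) else 0) else 0 := by
  have h := hqf l.length l'.length (fun k => lp.single 2 (l.get k) 1)
    (fun k => lp.single 2 (l'.get k) 1)
  have h1 : (List.ofFn fun k => CAR.creation (lp.single 2 (l.get k) (1 : ℂ))) = l.map bStar := by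
    conv_rhs => rw [← List.ofFn_get l, List.map_ofFn]
    rfl
  have h2 : (List.ofFn fun k => CAR.annihilation (lp.single 2 (l'.get k) (1 : ℂ)))
      = l'.map bAnn := by
    conv_rhs => rw [← List.ofFn_get l', List.map_ofFn]
    rfl
  rw [h1, h2] at h
  rw [normalMonomial, h]
  refine dite_congr rfl (fun h => ?_) fun _ => rfl
  congr 1
  ext j k
  rw [Matrix.of_apply, Matrix.of_apply, lp.inner_single_left]
  change inner ℂ (1 : ℂ) ((σ : ℂ) * (lp.single 2 (l.get (Fin.cast h k)) (1 : ℂ) : ℓ²(ℤ, ℂ))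
    (l'.get j)) = _
  rw [lp.single_apply, Pi.single_apply]
  split_ifs <;> simp

theorem quasiFree_one (hqf : IsQuasiFree ω ((σ : ℂ) • ContinuousLinearMap.id ℂ ℓ²(ℤ, ℂ))) :
    ω 1 = 1 := by
  have := quasiFree_normalMonomial hqf [] []
  simpa [normalMonomial] using this

theorem normalMonomial_cons_left (l l' : List ℤ) :
    normalMonomial (0 :: l) l' = (l.map bStar).reverse.prod * bStar 0 * (l'.map bAnn).prod := by
  simp [normalMonomial]

theorem normalMonomial_cons_right (l l' : List ℤ) :
    normalMonomial l (0 :: l') = (l.map bStar).reverse.prod * bAnn 0 * (l'.map bAnn).prod := by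
  simp [normalMonomial, mul_assoc]

theorem quasiFree_cons_left
    (hqf : IsQuasiFree ω ((σ : ℂ) • ContinuousLinearMap.id ℂ ℓ²(ℤ, ℂ))) (l : List ℤ)
    {l' : List ℤ} (hl' : ∀ i ∈ l', 1 ≤ i) : ω (normalMonomial (0 :: l) l') = 0 := by
  rw [quasiFree_normalMonomial hqf]
  split_ifs with h
  · refine Matrix.det_eq_zero_of_column_eq_zero ⟨0, by rw [h]; simp⟩ fun i => ?_
    have := hl' (l'.get i) (List.get_mem _ _)
    rw [Matrix.of_apply, if_neg]
    intro h0
    rw [h0] at this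
    simp at this
  · rfl

theorem quasiFree_cons_right
    (hqf : IsQuasiFree ω ((σ : ℂ) • ContinuousLinearMap.id ℂ ℓ²(ℤ, ℂ))) {l : List ℤ}
    (l' : List ℤ) (hl : ∀ i ∈ l, 1 ≤ i) : ω (normalMonomial l (0 :: l')) = 0 := by
  rw [quasiFree_normalMonomial hqf]
  split_ifs with h
  · refine Matrix.det_eq_zero_of_row_eq_zero ⟨0, by simp⟩ fun i => ?_
    have := hl (l.get (Fin.cast h i)) (List.get_mem _ _)
    rw [Matrix.of_apply, if_neg]
    intro h0
    rw [← h0] at this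
    simp at this
  · rfl

/-- The index `0` heads both lists and does not occur in `l`, so the first row of the determinant is
`(σ, 0, …, 0)`, and Laplace expansion leaves the smaller determinant. -/
theorem quasiFree_cons_cons
    (hqf : IsQuasiFree ω ((σ : ℂ) • ContinuousLinearMap.id ℂ ℓ²(ℤ, ℂ))) {l : List ℤ}
    (l' : List ℤ) (hl : ∀ i ∈ l, 1 ≤ i) :
    ω (normalMonomial (0 :: l) (0 :: l')) = σ * ω (normalMonomial l l') := by
  rw [quasiFree_normalMonomial hqf, quasiFree_normalMonomial hqf]
  by_cases h : l'.length = l.length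
  · have h' : (0 :: l').length = (0 :: l).length := by simp [h]
    rw [dif_pos h, dif_pos h']
    change Matrix.det (n := Fin (l'.length + 1)) _ = _
    rw [Matrix.det_succ_row_zero, Fin.sum_univ_succ, Finset.sum_eq_zero, add_zero]
    · simp only [Fin.val_zero, pow_zero, one_mul, Matrix.of_apply]
      rw [if_pos (by rfl)]
      rfl
    · intro i _
      have := hl (l.get (Fin.cast h i)) (List.get_mem _ _)
      rw [Matrix.of_apply, if_neg, mul_zero, zero_mul]
      intro h0
      change (0 : ℤ) = l.get (Fin.cast h i) at h0
      omega
  · rw [dif_neg h, dif_neg (by simpa using h), mul_zero]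

theorem quasiFree_bStar (hqf : IsQuasiFree ω ((σ : ℂ) • ContinuousLinearMap.id ℂ ℓ²(ℤ, ℂ))) :
    ω (bStar 0) = 0 := by
  simpa [normalMonomial] using quasiFree_cons_left hqf [] (l' := []) (by simp)

theorem quasiFree_bAnn (hqf : IsQuasiFree ω ((σ : ℂ) • ContinuousLinearMap.id ℂ ℓ²(ℤ, ℂ))) :
    ω (bAnn 0) = 0 := by
  simpa [normalMonomial] using quasiFree_cons_right hqf [] (l := []) (by simp)

theorem quasiFree_number (hqf : IsQuasiFree ω ((σ : ℂ) • ContinuousLinearMap.id ℂ ℓ²(ℤ, ℂ))) :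
    ω (bStar 0 * bAnn 0) = σ := by
  have := quasiFree_cons_cons hqf [] (l := []) (by simp)
  simpa [normalMonomial, quasiFree_one hqf] using this

/-- It suffices to take `w` among `1, b*_0, b_0, b*_0 b_0`. Moving its factors into the gap between
creators and annihilators gives, up to sign, a normally ordered monomial with `0` prepended to one
or both lists. A single `0` gives a zero row, a zero column or lists of unequal length; a pair gives
the factor `σ`, its two signs cancelling. -/
theorem quasiFree_normalMonomial_mul
    (hqf : IsQuasiFree ω ((σ : ℂ) • ContinuousLinearMap.id ℂ ℓ²(ℤ, ℂ))) {l l' : List ℤ}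
    (hl : ∀ i ∈ l, 1 ≤ i) (hl' : ∀ i ∈ l', 1 ≤ i) {w : CAR ℤ} (hw : w ∈ modeZero) :
    ω (normalMonomial l l' * w) = ω (normalMonomial l l') * ω w := by
  have key : ∀ v : CAR ℤ, v = bStar 0 ∨ v = bAnn 0 → normalMonomial l l' * v =
      (-1 : ℂ) ^ l'.length • ((l.map bStar).reverse.prod * v * (l'.map bAnn).prod) := by
    intro v hv
    rw [mul_assoc _ v, mul_bAnn_prod hv hl', normalMonomial, mul_smul_comm, ← mul_smul, ← pow_add,
      Even.neg_one_pow ⟨_, rfl⟩, one_smul, mul_assoc]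
  have hs := modeZero_le_span hw
  clear hw
  induction hs using Submodule.span_induction with
  | mem w h =>
    rcases h with rfl | rfl | rfl | rfl
    · rw [mul_one, quasiFree_one hqf, mul_one]
    · rw [key _ (Or.inl rfl), map_smul, ← normalMonomial_cons_left,
        quasiFree_cons_left hqf _ hl', quasiFree_bStar hqf, smul_zero, mul_zero]
    · rw [key _ (Or.inr rfl), map_smul, ← normalMonomial_cons_right,
        quasiFree_cons_right hqf _ hl, quasiFree_bAnn hqf, smul_zero, mul_zero]
    · have : normalMonomial l l' * (bStar 0 * bAnn 0) = normalMonomial (0 :: l) (0 :: l') := by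
        rw [← mul_assoc, key _ (Or.inl rfl), normalMonomial_cons_left, List.map_cons,
          List.prod_cons, mul_bAnn_prod (Or.inr rfl) hl', mul_smul_comm, smul_mul_assoc, mul_assoc,
          mul_assoc]
      rw [this, quasiFree_cons_cons hqf _ hl, quasiFree_number hqf, mul_comm]
  | zero => simp
  | add x y _ _ hx hy => rw [mul_add, map_add, map_add, hx, hy, mul_add]
  | smul c x _ hx =>
    rw [mul_smul_comm, map_smul, map_smul, hx, smul_eq_mul, smul_eq_mul, mul_left_comm]

/-- In the quasi-free state with constant density the mode `0` is independent of the modes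
`j ≥ 1`. -/
theorem quasiFree_sandwich
    (hqf : IsQuasiFree ω ((σ : ℂ) • ContinuousLinearMap.id ℂ ℓ²(ℤ, ℂ))) {x y z : CAR ℤ}
    (hx : x ∈ modeZero) (hy : y ∈ modeZero) (hz : z ∈ modesGE 1) :
    ω (x * z * y) = ω (x * y) * ω z := by
  have hs := modesGE_le_span 1 hz
  clear hz
  induction hs using Submodule.span_induction with
  | mem z h =>
    obtain ⟨l, l', hl, hl', rfl⟩ := h
    obtain ⟨x', hx', h1, h2⟩ := modeZero_mul_normalMonomial hl hl' hx
    rw [h1, mul_assoc, quasiFree_normalMonomial_mul hqf hl hl' (mul_mem hx' hy)]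
    -- A balanced monomial commutes with `x`; for an unbalanced one gauge invariance makes both
    -- sides zero.
    by_cases hll : l.length = l'.length
    · rw [h2 hll, mul_comm]
    · rw [quasiFree_normalMonomial hqf, dif_neg (Ne.symm hll), zero_mul, mul_zero]
  | zero => simp
  | add z w _ _ hz hw => rw [mul_add, add_mul, map_add, map_add, hz, hw, mul_add]
  | smul c z _ hz =>
    rw [mul_smul_comm, smul_mul_assoc, map_smul, map_smul, hz, smul_eq_mul, smul_eq_mul,
      mul_left_comm]

end QuasiFree

/-! ### Shift invariance -/

/-- The free evolution of the reservoir as an algebra homomorphism. -/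
def freeEvolutionHom : CAR ℤ →ₐ[ℂ] CAR ℤ where
  toFun := freeEvolution reservoirShift
  map_one' := Subtype.ext (map_one _)
  map_mul' x y := Subtype.ext (map_mul _ (x : Fock ℤ →L[ℂ] Fock ℤ) y)
  map_zero' := Subtype.ext (map_zero _)
  map_add' x y := Subtype.ext (map_add _ (x : Fock ℤ →L[ℂ] Fock ℤ) y)
  commutes' c := Subtype.ext
    ((Unitary.conjStarAlgAut ℂ _ (star (secondQuant reservoirShift))).toAlgEquiv.commutes c)

theorem coe_freeEvolutionHom (x : CAR ℤ) :
    (freeEvolutionHom x : Fock ℤ →L[ℂ] Fock ℤ) =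
      star (secondQuantOp reservoirShift) * x * secondQuantOp reservoirShift :=
  Unitary.conjStarAlgAut_star_apply _ _

theorem freeEvolutionHom_bStar (j : ℤ) : freeEvolutionHom (bStar j) = bStar (j + 1) := by
  apply Subtype.ext
  rw [coe_freeEvolutionHom, coe_bStar, coe_bStar, secondQuant_conj_creat]
  rfl

theorem freeEvolutionHom_bAnn (j : ℤ) : freeEvolutionHom (bAnn j) = bAnn (j + 1) := by
  apply Subtype.ext
  have h := congrArg star (congrArg Subtype.val (freeEvolutionHom_bStar j))
  rw [coe_freeEvolutionHom, coe_bStar, coe_bStar] at h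
  rw [coe_freeEvolutionHom, coe_bAnn, coe_bAnn]
  simpa [creat, mul_assoc] using h

theorem freeEvolutionHom_mem {k : ℤ} {x : CAR ℤ} (hx : x ∈ modesGE k) :
    freeEvolutionHom x ∈ modesGE (k + 1) := by
  induction hx using Algebra.adjoin_induction with
  | mem x h =>
    rcases h with ⟨j, hj, rfl⟩ | ⟨j, hj, rfl⟩
    · rw [freeEvolutionHom_bStar]
      exact bStar_mem_modesGE (by simpa using hj)
    · rw [freeEvolutionHom_bAnn]
      exact bAnn_mem_modesGE (by simpa using hj)
  | algebraMap c =>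
    rw [AlgHom.commutes]
    exact Subalgebra.algebraMap_mem _ c
  | add x y _ _ hx hy => rw [map_add]; exact add_mem hx hy
  | mul x y _ _ hx hy => rw [map_mul]; exact mul_mem hx hy

theorem freeEvolutionHom_normalMonomial (l l' : List ℤ) :
    freeEvolutionHom (normalMonomial l l') =
      normalMonomial (l.map (· + 1)) (l'.map (· + 1)) := by
  have h1 : (freeEvolutionHom ∘ bStar) = bStar ∘ (· + 1) := funext freeEvolutionHom_bStar
  have h2 : (freeEvolutionHom ∘ bAnn) = bAnn ∘ (· + 1) := funext freeEvolutionHom_bAnn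
  simp only [normalMonomial, map_mul, map_list_prod, List.map_reverse, List.map_map, h1, h2]

/-- The determinant depends only on which indices coincide, and adding one to all of them preserves
coincidences. Working in `modesGE k`, an algebraic span, avoids any density argument. -/
theorem quasiFree_freeEvolutionHom {σ : ℝ} {ω : CAR ℤ →L[ℂ] ℂ}
    (hqf : IsQuasiFree ω ((σ : ℂ) • ContinuousLinearMap.id ℂ ℓ²(ℤ, ℂ))) {k : ℤ} {x : CAR ℤ}
    (hx : x ∈ modesGE k) : ω (freeEvolutionHom x) = ω x := by
  have hs := modesGE_le_span k hx
  clear hx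
  induction hs using Submodule.span_induction with
  | mem z h =>
    obtain ⟨l, l', -, -, rfl⟩ := h
    rw [freeEvolutionHom_normalMonomial, quasiFree_normalMonomial hqf,
      quasiFree_normalMonomial hqf]
    by_cases h : l'.length = l.length
    · rw [dif_pos h, dif_pos (by simpa using h),
        ← Matrix.det_reindex_self (finCongr (List.length_map (as := l') (· + 1)).symm)]
      congr 1
      ext i j
      simp
    · rw [dif_neg h, dif_neg (by simpa using h)]
  | zero => simp
  | add z w _ _ hz hw => rw [map_add, map_add, map_add, hz, hw]
  | smul c z _ hz => rw [map_smul, map_smul, map_smul, hz]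

/-! ### Matrices of sample operators -/

section SampleMatrices

variable {d : ℕ}

/-- Matrices indexed by the occupation number basis of the sample. -/
abbrev SampleMat (d : ℕ) : Type := Matrix (Finset (Fin d)) (Finset (Fin d)) ℂ

/-- The matrix of a sample operator in the occupation number basis. -/
def toMat (A : SampleOp d) : SampleMat d := Matrix.of fun S T => A (basisVec T) S

theorem toMat_apply (A : SampleOp d) (S T : Finset (Fin d)) : toMat A S T = A (basisVec T) S := rfl

theorem eq_sum_basisVec (f : Fock (Fin d)) : f = ∑ S, f S • basisVec S := by
  ext T
  rw [lp.coeFn_sum, Finset.sum_apply]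
  simp [basisVec_apply]

theorem apply_eq_sum_toMat (A : SampleOp d) (f : Fock (Fin d)) (S : Finset (Fin d)) :
    A f S = ∑ T, toMat A S T * f T := by
  conv_lhs => rw [eq_sum_basisVec f, map_sum, lp.coeFn_sum, Finset.sum_apply]
  simp [toMat_apply, mul_comm]

theorem toMat_mul (A B : SampleOp d) : toMat (A * B) = toMat A * toMat B := by
  ext S T
  rw [toMat_apply, Matrix.mul_apply]
  exact apply_eq_sum_toMat A _ S

theorem toMat_add (A B : SampleOp d) : toMat (A + B) = toMat A + toMat B := rfl

theorem toMat_smul (c : ℂ) (A : SampleOp d) : toMat (c • A) = c • toMat A := rfl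

theorem toMat_zero : toMat (0 : SampleOp d) = 0 := rfl

theorem toMat_one : toMat (1 : SampleOp d) = 1 := by
  ext S T
  rw [toMat_apply, Matrix.one_apply]
  exact basisVec_apply T S

theorem toMat_star (A : SampleOp d) : toMat (star A) = star (toMat A) := by
  ext S T
  rw [Matrix.star_apply, toMat_apply, toMat_apply, ← inner_basisVec,
    ContinuousLinearMap.star_eq_adjoint, ContinuousLinearMap.adjoint_inner_right,
    ← inner_conj_symm, inner_basisVec]
  rfl

/-- The matrix of the annihilation operator. -/
def annMat (j : Fin d) : SampleMat d := toMat (annih j)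

theorem toMat_creat (j : Fin d) : toMat (creat j) = star (annMat j) := toMat_star _

theorem annMat_mul_self (j : Fin d) : annMat j * annMat j = 0 := by
  rw [annMat, ← toMat_mul, annih_mul_self, toMat_zero]

theorem annMat_mul_star (j : Fin d) : annMat j * star (annMat j) + star (annMat j) * annMat j = 1 := by
  rw [annMat, ← toMat_star, ← toMat_mul, ← toMat_mul, ← toMat_add, ← toMat_one]
  have := annih_creat j j
  rw [if_pos rfl] at this
  exact congrArg toMat this

theorem annMat_mul_star_mul (j : Fin d) : annMat j * star (annMat j) * annMat j = annMat j := by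
  rw [eq_sub_of_add_eq (annMat_mul_star j), sub_mul, one_mul, mul_assoc, annMat_mul_self, mul_zero,
    sub_zero]

theorem star_annMat_mul_self (j : Fin d) : star (annMat j) * star (annMat j) = 0 := by
  rw [← star_mul, annMat_mul_self, star_zero]

/-- The unitary matrix of the free evolution of the sample. -/
def shiftMat (d : ℕ) [NeZero d] : unitary (SampleMat d) :=
  ⟨toMat (secondQuantOp (sampleShift d)), by
    have h := (secondQuant (sampleShift d)).2
    rw [Unitary.mem_iff] at h ⊢
    constructor
    · rw [← toMat_star, ← toMat_mul, ← toMat_one]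
      exact congrArg toMat h.1
    · rw [← toMat_star, ← toMat_mul, ← toMat_one]
      exact congrArg toMat h.2⟩

end SampleMatrices

/-! ### Tensor products over a general algebra -/

section Tensor

variable {d : ℕ} {B : Type*} [Ring B] [Algebra ℂ B]

/-- The elementary tensor `b ⊗ A`. -/
def tensorMat (b : B) (A : SampleMat d) : Matrix (Finset (Fin d)) (Finset (Fin d)) B :=
  Matrix.of fun S T => A S T • b

theorem tensorMat_apply (b : B) (A : SampleMat d) (S T : Finset (Fin d)) :
    tensorMat b A S T = A S T • b := rfl

theorem tensorMat_mul (b b' : B) (A A' : SampleMat d) :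
    tensorMat b A * tensorMat b' A' = tensorMat (b * b') (A * A') := by
  ext S T
  simp only [Matrix.mul_apply, tensorMat_apply, smul_mul_smul_comm, Finset.sum_smul]

theorem tensorMat_add_left (b b' : B) (A : SampleMat d) :
    tensorMat (b + b') A = tensorMat b A + tensorMat b' A := by
  ext S T
  exact smul_add (A S T) b b'

theorem tensorMat_add_right (b : B) (A A' : SampleMat d) :
    tensorMat b (A + A') = tensorMat b A + tensorMat b A' := by
  ext S T
  exact add_smul (A S T) (A' S T) b

theorem tensorMat_smul (c : ℂ) (b : B) (A : SampleMat d) :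
    tensorMat b (c • A) = c • tensorMat b A := by
  ext S T
  exact mul_smul c (A S T) b

theorem tensorMat_zero_left (A : SampleMat d) : tensorMat (0 : B) A = 0 := by
  ext S T
  exact smul_zero (A S T)

theorem tensorMat_one : tensorMat (1 : B) (1 : SampleMat d) = 1 := by
  ext S T
  rw [tensorMat_apply, Matrix.one_apply, Matrix.one_apply]
  split_ifs <;> simp

theorem star_tensorMat [StarRing B] [StarModule ℂ B] (b : B) (A : SampleMat d) :
    star (tensorMat b A) = tensorMat (star b) (star A) := by
  ext S T
  rw [Matrix.star_apply, tensorMat_apply, tensorMat_apply, star_smul, Matrix.star_apply]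

theorem map_tensorMat (f : B →ₗ[ℂ] ℂ) (b : B) (A : SampleMat d) :
    (tensorMat b A).map f = f b • A := by
  ext S T
  rw [Matrix.map_apply, tensorMat_apply, map_smul, Matrix.smul_apply, smul_eq_mul, smul_eq_mul,
    mul_comm]

/-- All odd powers of `Q` equal `Q` and all positive even powers equal `Q * Q`, so the series splits
into a hyperbolic sine and a hyperbolic cosine. -/
theorem exp_smul_of_mul_mul_self {R : Type*} [Ring R] [Algebra ℂ R] [TopologicalSpace R]
    [T2Space R] [IsTopologicalRing R] [ContinuousSMul ℂ R] (z : ℂ) {Q : R}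
    (hQ : Q * (Q * Q) = Q) :
    NormedSpace.exp (z • Q) = 1 + (Complex.cosh z - 1) • (Q * Q) + Complex.sinh z • Q := by
  have hpow : ∀ n : ℕ, Q ^ (2 * n + 1) = Q ∧ Q ^ (2 * n + 2) = Q * Q := by
    intro n
    induction n with
    | zero => simp [pow_two]
    | succ n ih =>
      have h1 : Q ^ (2 * (n + 1) + 1) = Q := by
        rw [show 2 * (n + 1) + 1 = (2 * n + 2) + 1 by ring, pow_succ', ih.2, hQ]
      exact ⟨h1, by rw [show 2 * (n + 1) + 2 = (2 * (n + 1) + 1) + 1 by ring, pow_succ, h1]⟩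
  have e1 : HasSum (fun n : ℕ => z ^ n / (n.factorial : ℂ)) (Complex.exp z) := by
    rw [Complex.exp_eq_exp_ℂ]
    exact NormedSpace.expSeries_div_hasSum_exp z
  have e2 : HasSum (fun n : ℕ => (-z) ^ n / (n.factorial : ℂ)) (Complex.exp (-z)) := by
    rw [Complex.exp_eq_exp_ℂ]
    exact NormedSpace.expSeries_div_hasSum_exp (-z)
  -- The last summand corrects the term of index zero, which is `1` and not `Q * Q`.
  have h := ((((e1.add e2).div_const 2).smul_const (Q * Q)).add
    (((e1.sub e2).div_const 2).smul_const Q)).add (hasSum_ite_eq (0 : ℕ) (1 - Q * Q))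
  rw [NormedSpace.exp_eq_tsum ℂ]
  refine (HasSum.tsum_eq (a := ((Complex.exp z + Complex.exp (-z)) / 2) • (Q * Q) +
    ((Complex.exp z - Complex.exp (-z)) / 2) • Q + (1 - Q * Q)) ?_).trans ?_
  · convert h using 1
    ext1 n
    rw [smul_pow]
    rcases n with _ | n
    · simp
    · rw [if_neg (Nat.succ_ne_zero n), add_zero]
      rcases Nat.even_or_odd' n with ⟨k, rfl | rfl⟩
      · rw [(hpow k).1, Odd.neg_pow ⟨k, rfl⟩, smul_smul]
        have h1 : (z ^ (2 * k + 1) / ((2 * k + 1).factorial : ℂ) +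
          -z ^ (2 * k + 1) / ((2 * k + 1).factorial : ℂ)) / 2 = 0 := by ring
        rw [h1, zero_smul, zero_add]
        congr 1
        ring
      · rw [show 2 * k + 1 + 1 = 2 * k + 2 by ring, (hpow k).2,
          Even.neg_pow ⟨k + 1, by ring⟩, smul_smul, sub_self, zero_div, zero_smul, add_zero]
        congr 1
        ring
  · rw [Complex.cosh, Complex.sinh, sub_smul, one_smul]
    abel

/-- The one-step map of a single site, `A ↦ (ω ⊗ id)(K* (1 ⊗ A) K)`, with the coupling at the
site `j`. -/
def siteMap (α σ : ℝ) (j : Fin d) (A : SampleMat d) : SampleMat d :=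
  (σ : ℂ) • ((star (annMat j) * annMat j + (Real.cos α : ℂ) • (annMat j * star (annMat j))) * A *
      (star (annMat j) * annMat j + (Real.cos α : ℂ) • (annMat j * star (annMat j)))
    + ((Real.sin α : ℂ) ^ 2) • (annMat j * A * star (annMat j)))
  + (1 - (σ : ℂ)) •
    ((annMat j * star (annMat j) + (Real.cos α : ℂ) • (star (annMat j) * annMat j)) * A *
      (annMat j * star (annMat j) + (Real.cos α : ℂ) • (star (annMat j) * annMat j))
    + ((Real.sin α : ℂ) ^ 2) • (star (annMat j) * A * annMat j))

/-- The explicit form of `exp[-iα (b* ⊗ a + b ⊗ a*)]`. -/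
def couplingMat (α : ℝ) (b c : B) (j : Fin d) : Matrix (Finset (Fin d)) (Finset (Fin d)) B :=
  tensorMat (c * b) (star (annMat j) * annMat j + (Real.cos α : ℂ) • (annMat j * star (annMat j)))
  + tensorMat (b * c)
    (annMat j * star (annMat j) + (Real.cos α : ℂ) • (star (annMat j) * annMat j))
  + (tensorMat c ((-(Complex.I * Real.sin α)) • annMat j)
  + tensorMat b ((-(Complex.I * Real.sin α)) • star (annMat j)))

/-- The hopping term exchanges the two configurations in which exactly one of the two modes is
occupied and kills the other two. Its square is therefore the projection onto the former and its
cube is itself. -/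
theorem exp_hopping [TopologicalSpace B] [T2Space B] [IsTopologicalRing B] [ContinuousSMul ℂ B]
    (α : ℝ) {b c : B} (hbb : b * b = 0) (hcc : c * c = 0) (hbc : b * c + c * b = 1) (j : Fin d) :
    NormedSpace.exp ((-(Complex.I * α)) • (tensorMat c (annMat j) + tensorMat b (star (annMat j))))
      = couplingMat α b c j := by
  have hbcb : b * c * b = b := by
    rw [eq_sub_of_add_eq hbc, sub_mul, one_mul, mul_assoc, hbb, mul_zero, sub_zero]
  have hcbc : c * (b * c) = c := by
    rw [eq_sub_of_add_eq hbc, mul_sub, mul_one, ← mul_assoc, hcc, zero_mul, sub_zero]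
  have ha := annMat_mul_self j
  have ha' := star_annMat_mul_self j
  have haa := annMat_mul_star_mul j
  have haa' : star (annMat j) * (annMat j * star (annMat j)) = star (annMat j) := by
    have := congrArg star haa
    simpa [mul_assoc] using this
  have hQQ : (tensorMat c (annMat j) + tensorMat b (star (annMat j))) *
      (tensorMat c (annMat j) + tensorMat b (star (annMat j))) =
      tensorMat (c * b) (annMat j * star (annMat j)) +
        tensorMat (b * c) (star (annMat j) * annMat j) := by
    simp only [add_mul, mul_add, tensorMat_mul, hbb, hcc, tensorMat_zero_left, zero_add, add_zero]
    exact add_comm _ _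
  rw [exp_smul_of_mul_mul_self, hQQ]
  · have h1 : (1 : Matrix (Finset (Fin d)) (Finset (Fin d)) B) =
        tensorMat (c * b) (annMat j * star (annMat j)) +
        tensorMat (c * b) (star (annMat j) * annMat j) +
        (tensorMat (b * c) (annMat j * star (annMat j)) +
        tensorMat (b * c) (star (annMat j) * annMat j)) := by
      rw [← tensorMat_add_right, ← tensorMat_add_right, annMat_mul_star, ← tensorMat_add_left,
        add_comm (c * b), hbc, tensorMat_one]
    have hc : Complex.cosh (-(Complex.I * α)) = Real.cos α := by
      rw [Complex.cosh_neg, mul_comm, Complex.cosh_mul_I, Complex.ofReal_cos]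
    have hs : Complex.sinh (-(Complex.I * α)) = -(Complex.I * Real.sin α) := by
      rw [Complex.sinh_neg, mul_comm, Complex.sinh_mul_I, Complex.ofReal_sin, mul_comm]
    rw [h1, hc, hs, couplingMat]
    simp only [tensorMat_add_right, tensorMat_smul]
    module
  · rw [hQQ]
    simp only [add_mul, mul_add, tensorMat_mul, ← mul_assoc, hbb, hcc, ha, ha', zero_mul,
      tensorMat_zero_left, add_zero, zero_add, hbcb, haa]
    rw [mul_assoc c, hcbc, mul_assoc (star _), haa', add_comm]

theorem star_couplingMat [StarRing B] [StarModule ℂ B] (α : ℝ) {b c : B} (hc : star b = c)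
    (j : Fin d) : star (couplingMat α b c j) = couplingMat (-α) b c j := by
  subst hc
  have hI : star (-(Complex.I * (Real.sin α : ℂ))) = Complex.I * Real.sin α := by
    simp [-Complex.ofReal_sin]
  simp only [couplingMat, star_add, star_tensorMat, star_mul, star_star, star_smul, hI,
    Real.cos_neg, Real.sin_neg, Complex.ofReal_neg, mul_neg, neg_neg, Complex.star_def,
    Complex.conj_ofReal]
  rw [add_comm (tensorMat (star b) _)]

/-- Expanding the conjugation, the terms of odd degree in `b, c` are killed by `f`; the others
reduce to `c * b` or `b * c`, weighted `σ` and `1 - σ`. -/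
theorem map_coupling_conj (α σ : ℝ) (f : B →ₗ[ℂ] ℂ) {b c : B} (hbb : b * b = 0) (hcc : c * c = 0)
    (hbc : b * c + c * b = 1) (h1 : f 1 = 1) (hb : f b = 0) (hc : f c = 0) (hn : f (c * b) = σ)
    (j : Fin d) (A : SampleMat d) :
    (couplingMat (-α) b c j * tensorMat 1 A * couplingMat α b c j).map f = siteMap α σ j A := by
  have hm : f (b * c) = 1 - σ := by
    rw [eq_sub_of_add_eq hbc, map_sub, h1, hn]
  have e1 : b * c * b = b := by
    rw [eq_sub_of_add_eq hbc, sub_mul, one_mul, mul_assoc, hbb, mul_zero, sub_zero]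
  have e2 : c * b * c = c := by
    rw [eq_sub_of_add_eq' hbc, sub_mul, one_mul, mul_assoc, hcc, mul_zero, sub_zero]
  have e3 : b * c * c = 0 := by rw [mul_assoc, hcc, mul_zero]
  have e4 : c * b * b = 0 := by rw [mul_assoc, hbb, mul_zero]
  have hmap : ∀ X Y : Matrix (Finset (Fin d)) (Finset (Fin d)) B,
      (X + Y).map f = X.map f + Y.map f := fun X Y => Matrix.map_add _ (map_add f) _ _
  simp only [couplingMat, add_mul, mul_add, tensorMat_mul, mul_one, hmap, map_tensorMat,
    ← mul_assoc, hbb, hcc, e1, e2, e3, e4, zero_mul, map_zero, hb, hc, hn, hm, zero_smul, add_zero,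
    zero_add]
  -- The two hopping amplitudes `i sin α` and `-i sin α` combine to `sin² α`.
  have h2 : ∀ x s : ℂ, -(x * Complex.I * s) * Complex.I * s = x * s ^ 2 := by
    intro x s
    linear_combination (-x * s ^ 2) * Complex.I_mul_I
  simp only [siteMap, Real.cos_neg, Real.sin_neg, smul_mul_assoc, mul_smul_comm, smul_smul,
    add_mul, mul_add, smul_add, ← mul_assoc, Complex.ofReal_neg, mul_neg, neg_neg, h2]
  module

end Tensor

/-! ### Reduction to the sample -/

section Reduction

variable {d : ℕ}

theorem tensor_eq_tensorMat (b : CAR ℤ) (A : SampleOp d) : tensor b A = tensorMat b (toMat A) := by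
  ext1 S T
  rw [tensor, Matrix.of_apply, inner_basisVec]
  rfl

theorem coupling_eq_couplingMat [NeZero d] (α : ℝ) :
    coupling d α = couplingMat α (bAnn 0) (bStar 0) 0 := by
  have h := bAnn_bStar 0 0
  rw [if_pos rfl] at h
  rw [coupling, tensor_eq_tensorMat, tensor_eq_tensorMat, toMat_creat]
  exact exp_hopping α (bAnn_mul_self 0) (bStar_mul_self 0) h 0

theorem couplingMat_mem (α : ℝ) (j : Fin d) (S T : Finset (Fin d)) :
    couplingMat α (bAnn 0) (bStar 0) j S T ∈ modeZero := by
  have h1 := bAnn_mem_modeZero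
  have h2 := bStar_mem_modeZero
  exact add_mem (add_mem (Subalgebra.smul_mem _ (mul_mem h2 h1) _)
    (Subalgebra.smul_mem _ (mul_mem h1 h2) _))
    (add_mem (Subalgebra.smul_mem _ h2 _) (Subalgebra.smul_mem _ h1 _))

theorem mul_mem_entries {B : Type*} [Ring B] [Algebra ℂ B] (𝒮 : Subalgebra ℂ B)
    {X Y : Matrix (Finset (Fin d)) (Finset (Fin d)) B} (hX : ∀ S T, X S T ∈ 𝒮)
    (hY : ∀ S T, Y S T ∈ 𝒮) (S T : Finset (Fin d)) : (X * Y) S T ∈ 𝒮 := by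
  rw [Matrix.mul_apply]
  exact sum_mem fun U _ => mul_mem (hX S U) (hY U T)

theorem tensorMat_one_mem_entries {B : Type*} [Ring B] [Algebra ℂ B] (𝒮 : Subalgebra ℂ B)
    (A : SampleMat d) (S T : Finset (Fin d)) : tensorMat (1 : B) A S T ∈ 𝒮 :=
  Subalgebra.smul_mem _ (one_mem _) _

theorem map_mul_tensorMat_one {B : Type*} [Ring B] [Algebra ℂ B] (f : B →ₗ[ℂ] ℂ)
    (X : Matrix (Finset (Fin d)) (Finset (Fin d)) B) (A : SampleMat d) :
    (X * tensorMat 1 A).map f = X.map f * A := by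
  ext S T
  rw [Matrix.map_apply, Matrix.mul_apply, Matrix.mul_apply, map_sum]
  refine Finset.sum_congr rfl fun U _ => ?_
  rw [tensorMat_apply, mul_smul_comm, mul_one, map_smul, smul_eq_mul, mul_comm, Matrix.map_apply]

theorem map_tensorMat_one_mul {B : Type*} [Ring B] [Algebra ℂ B] (f : B →ₗ[ℂ] ℂ)
    (X : Matrix (Finset (Fin d)) (Finset (Fin d)) B) (A : SampleMat d) :
    (tensorMat 1 A * X).map f = A * X.map f := by
  ext S T
  rw [Matrix.map_apply, Matrix.mul_apply, Matrix.mul_apply, map_sum]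
  refine Finset.sum_congr rfl fun U _ => ?_
  rw [tensorMat_apply, smul_mul_assoc, one_mul, map_smul, smul_eq_mul, Matrix.map_apply]

/-- Independence of `Z` from `X` and `Y` under `f`, entry by entry, allows `Z` to be averaged first.
-/
theorem map_sandwich {B : Type*} [Ring B] [Algebra ℂ B] (f : B →ₗ[ℂ] ℂ)
    {X Y Z : Matrix (Finset (Fin d)) (Finset (Fin d)) B}
    (h : ∀ S U V T, f (X S U * Z U V * Y V T) = f (X S U * Y V T) * f (Z U V)) :
    (X * Z * Y).map f = (X * tensorMat 1 (Z.map f) * Y).map f := by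
  ext S T
  simp only [Matrix.map_apply, Matrix.mul_apply, Finset.sum_mul, map_sum, h, tensorMat_apply,
    mul_smul_comm, mul_one, smul_mul_assoc, map_smul, smul_eq_mul]
  simp only [mul_comm]

variable {σ : ℝ} {ω : CAR ℤ →L[ℂ] ℂ}

/-- The free evolution of the sample in the occupation number basis. -/
def shiftConj [NeZero d] : SampleMat d ≃⋆ₐ[ℂ] SampleMat d :=
  Unitary.conjStarAlgAut ℂ (SampleMat d) (star (shiftMat d))

theorem shiftConj_apply [NeZero d] (A : SampleMat d) :
    shiftConj A = star (shiftMat d : SampleMat d) * A * shiftMat d :=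
  Unitary.conjStarAlgAut_star_apply _ _

/-- One step of the reduced evolution of the sample. -/
def reducedStep [NeZero d] (α σ : ℝ) (A : SampleMat d) : SampleMat d :=
  siteMap α σ 0 (shiftConj A)

theorem freeStep_eq [NeZero d] (X : CompositeAlg d) :
    freeStep X = tensorMat 1 (star (shiftMat d : SampleMat d)) * X.map freeEvolutionHom *
      tensorMat 1 (shiftMat d : SampleMat d) := by
  rw [freeStep, tensor_eq_tensorMat, star_tensorMat, star_one]
  rfl

theorem freeStep_mem [NeZero d] {X : CompositeAlg d} (hX : ∀ S T, X S T ∈ modesGE 0)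
    (S T : Finset (Fin d)) : freeStep X S T ∈ modesGE 1 := by
  rw [freeStep_eq]
  exact mul_mem_entries _ (mul_mem_entries _ (tensorMat_one_mem_entries _ _)
    fun S T => freeEvolutionHom_mem (hX S T)) (tensorMat_one_mem_entries _ _) S T

theorem map_freeStep [NeZero d]
    (hqf : IsQuasiFree ω ((σ : ℂ) • ContinuousLinearMap.id ℂ ℓ²(ℤ, ℂ))) {X : CompositeAlg d}
    (hX : ∀ S T, X S T ∈ modesGE 0) :
    (freeStep X).map (ω : CAR ℤ →ₗ[ℂ] ℂ) = shiftConj (X.map (ω : CAR ℤ →ₗ[ℂ] ℂ)) := by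
  rw [freeStep_eq, map_mul_tensorMat_one, map_tensorMat_one_mul, shiftConj_apply]
  congr 2
  ext S T
  exact quasiFree_freeEvolutionHom hqf (hX S T)

theorem step_eq [NeZero d] (α : ℝ) (X : CompositeAlg d) :
    step α X = couplingMat (-α) (bAnn 0) (bStar 0) 0 * freeStep X *
      couplingMat α (bAnn 0) (bStar 0) 0 := by
  rw [step, coupling_eq_couplingMat, star_couplingMat α (star_bAnn 0)]

theorem step_mem [NeZero d] (α : ℝ) {X : CompositeAlg d} (hX : ∀ S T, X S T ∈ modesGE 0)
    (S T : Finset (Fin d)) : step α X S T ∈ modesGE 0 := by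
  rw [step_eq]
  exact mul_mem_entries _ (mul_mem_entries _ (fun S T => modeZero_le (couplingMat_mem _ _ S T))
    fun S T => modesGE_anti zero_le_one (freeStep_mem hX S T))
    (fun S T => modeZero_le (couplingMat_mem _ _ S T)) S T

/-- This is the Markov property: after the free step the observable involves only modes that are
independent of the mode coupled by `K`. -/
theorem map_step [NeZero d] (α : ℝ)
    (hqf : IsQuasiFree ω ((σ : ℂ) • ContinuousLinearMap.id ℂ ℓ²(ℤ, ℂ))) {X : CompositeAlg d}
    (hX : ∀ S T, X S T ∈ modesGE 0) :
    (step α X).map (ω : CAR ℤ →ₗ[ℂ] ℂ) = reducedStep α σ (X.map (ω : CAR ℤ →ₗ[ℂ] ℂ)) := by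
  have h := bAnn_bStar 0 0
  rw [if_pos rfl] at h
  rw [step_eq, map_sandwich, map_freeStep hqf hX, map_coupling_conj α σ _ (bAnn_mul_self 0)
    (bStar_mul_self 0) h (quasiFree_one hqf) (quasiFree_bAnn hqf) (quasiFree_bStar hqf)
    (quasiFree_number hqf)]
  · rfl
  · intro S U V T
    exact quasiFree_sandwich hqf (couplingMat_mem _ _ _ _) (couplingMat_mem _ _ _ _)
      (freeStep_mem hX _ _)

/-- The support condition is carried along because `map_step` needs it at every step. -/
theorem map_step_iterate [NeZero d] (α : ℝ)
    (hqf : IsQuasiFree ω ((σ : ℂ) • ContinuousLinearMap.id ℂ ℓ²(ℤ, ℂ))) (A : SampleOp d) (t : ℕ) :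
    (∀ S T, (step α)^[t] (tensor 1 A) S T ∈ modesGE 0) ∧
    ((step α)^[t] (tensor 1 A)).map (ω : CAR ℤ →ₗ[ℂ] ℂ) = (reducedStep α σ)^[t] (toMat A) := by
  induction t with
  | zero =>
    rw [Function.iterate_zero, id, tensor_eq_tensorMat]
    refine ⟨tensorMat_one_mem_entries _ _, ?_⟩
    rw [map_tensorMat]
    change ω 1 • toMat A = _
    rw [quasiFree_one hqf, one_smul]
    rfl
  | succ t ih =>
    rw [Function.iterate_succ_apply', Function.iterate_succ_apply']
    exact ⟨step_mem α ih.1, by rw [map_step α hqf ih.1, ih.2]⟩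

theorem sampleState_eq [NeZero d] (α : ℝ)
    (hqf : IsQuasiFree ω ((σ : ℂ) • ContinuousLinearMap.id ℂ ℓ²(ℤ, ℂ))) (ρ A : SampleOp d)
    (t : ℕ) :
    sampleState α ω ρ t A = ∑ S, ∑ T, toMat ρ T S * (reducedStep α σ)^[t] (toMat A) S T := by
  rw [← (map_step_iterate α hqf A t).2, sampleState, productState]
  simp only [inner_basisVec]
  rfl

end Reduction

/-! ### The reduced evolution in the occupation number basis -/

section SiteMap

variable {d : ℕ}

theorem star_annMat_mul_apply (j : Fin d) (X : SampleMat d) (S T : Finset (Fin d)) :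
    (star (annMat j) * X) S T = (if j ∈ S then fermiSign j S else 0) * X (S.erase j) T := by
  rw [← toMat_creat, Matrix.mul_apply]
  simp only [toMat_apply, creat_apply, basisVec_apply]
  simp

theorem annMat_mul_apply (j : Fin d) (X : SampleMat d) (S T : Finset (Fin d)) :
    (annMat j * X) S T = (if j ∈ S then 0 else fermiSign j S) * X (insert j S) T := by
  rw [annMat, Matrix.mul_apply]
  simp only [toMat_apply, annih_apply, basisVec_apply]
  simp

theorem star_fermiSign {ι : Type*} [LinearOrder ι] (j : ι) (S : Finset ι) :
    star (fermiSign j S) = fermiSign j S := by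
  simp [fermiSign]

theorem mul_annMat_apply (j : Fin d) (X : SampleMat d) (S T : Finset (Fin d)) :
    (X * annMat j) S T = (if j ∈ T then fermiSign j T else 0) * X S (T.erase j) := by
  have h := congrArg star (star_annMat_mul_apply j (star X) T S)
  rw [← star_mul, Matrix.star_apply, star_star] at h
  rw [h, star_mul', Matrix.star_apply, star_star]
  split_ifs <;> simp [star_fermiSign]

theorem mul_star_annMat_apply (j : Fin d) (X : SampleMat d) (S T : Finset (Fin d)) :
    (X * star (annMat j)) S T = (if j ∈ T then 0 else fermiSign j T) * X S (insert j T) := by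
  have h := congrArg star (annMat_mul_apply j (star X) T S)
  rw [← star_star (annMat j), ← star_mul, Matrix.star_apply, star_star] at h
  rw [h, star_mul', Matrix.star_apply, star_star]
  split_ifs <;> simp [star_fermiSign]

/-- This exhibits the dynamics of one site: coherences at `j` are multiplied by `cos α`, while an
occupied site empties with probability `(1 - σ) sin² α` and an empty one fills with probability `σ
sin² α`. -/
theorem siteMap_apply (α σ : ℝ) (j : Fin d) (A : SampleMat d) (S T : Finset (Fin d)) :
    siteMap α σ j A S T =
      if j ∈ S then
        if j ∈ T then ((σ : ℂ) + (1 - σ) * Real.cos α ^ 2) * A S T +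
          (1 - σ) * Real.sin α ^ 2 * (fermiSign j S * fermiSign j T * A (S.erase j) (T.erase j))
        else Real.cos α * A S T
      else
        if j ∈ T then Real.cos α * A S T
        else ((σ : ℂ) * Real.cos α ^ 2 + (1 - σ)) * A S T +
          σ * Real.sin α ^ 2 * (fermiSign j S * fermiSign j T * A (insert j S) (insert j T)) := by
  have hins : ∀ S : Finset (Fin d), j ∉ S → fermiSign j (insert j S) = fermiSign j S := by
    intro S hS
    rw [← fermiSign_erase j (insert j S), Finset.erase_insert hS]
  simp only [siteMap, Matrix.add_apply, Matrix.smul_apply, smul_eq_mul, add_mul, mul_add,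
    smul_mul_assoc, mul_smul_comm, mul_assoc (star (annMat j)), mul_assoc (annMat j)]
  simp only [← mul_assoc _ (annMat j) (star (annMat j)), ← mul_assoc _ (star (annMat j)) (annMat j)]
  simp only [annMat_mul_apply, star_annMat_mul_apply, mul_annMat_apply, mul_star_annMat_apply]
  have hS : ∀ x, fermiSign j S * (fermiSign j S * x) = x := fun x => by
    rw [← mul_assoc, fermiSign_mul_self, one_mul]
  have hT : ∀ x, fermiSign j T * (fermiSign j T * x) = x := fun x => by
    rw [← mul_assoc, fermiSign_mul_self, one_mul]
  by_cases h1 : j ∈ S <;> by_cases h2 : j ∈ T <;>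
    simp only [h1, h2, fermiSign_erase, hins, Finset.insert_erase, Finset.erase_insert, if_true,
      if_false, Finset.mem_insert_self, Finset.notMem_erase, hS, hT, zero_mul, mul_zero, add_zero,
      zero_add, not_false_eq_true] <;>
    ring

end SiteMap

/-! ### Convergence of the reduced evolution -/

section Convergence

variable {d : ℕ}

/-! ### The sample shift in the occupation basis. -/

theorem star_shiftMat_mul_apply [NeZero d] (X : SampleMat d) (S T : Finset (Fin d)) :
    (star (shiftMat d : SampleMat d) * X) S T =
      sortSign (sampleShift d) S * X (S.map (sampleShift d).toEmbedding) T := by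
  have h : star (shiftMat d : SampleMat d) = toMat (star (secondQuantOp (sampleShift d))) :=
    (toMat_star _).symm
  rw [h, Matrix.mul_apply]
  simp only [toMat_apply, star_secondQuantOp_apply, basisVec_apply]
  simp

theorem star_sortSign {ι : Type*} [LinearOrder ι] (π : Equiv.Perm ι) (S : Finset ι) :
    star (sortSign π S) = sortSign π S := by
  simp [sortSign]

theorem mul_shiftMat_apply [NeZero d] (X : SampleMat d) (S T : Finset (Fin d)) :
    (X * (shiftMat d : SampleMat d)) S T =
      sortSign (sampleShift d) T * X S (T.map (sampleShift d).toEmbedding) := by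
  have h := congrArg star (star_shiftMat_mul_apply (star X) T S)
  rwa [← star_mul, Matrix.star_apply, star_star, star_mul', Matrix.star_apply, star_star,
    star_sortSign] at h

theorem shiftConj_apply_apply [NeZero d] (A : SampleMat d) (S T : Finset (Fin d)) :
    shiftConj A S T = sortSign (sampleShift d) T * (sortSign (sampleShift d) S *
      A (S.map (sampleShift d).toEmbedding) (T.map (sampleShift d).toEmbedding)) := by
  rw [shiftConj_apply, mul_shiftMat_apply, star_shiftMat_mul_apply]

theorem shiftConj_apply_self [NeZero d] (A : SampleMat d) (S : Finset (Fin d)) :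
    shiftConj A S S = A (S.map (sampleShift d).toEmbedding) (S.map (sampleShift d).toEmbedding) := by
  rw [shiftConj_apply_apply, ← mul_assoc, sortSign_mul_self, one_mul]

theorem norm_shiftConj_apply [NeZero d] (A : SampleMat d) (S T : Finset (Fin d)) :
    ‖shiftConj A S T‖ =
      ‖A (S.map (sampleShift d).toEmbedding) (T.map (sampleShift d).toEmbedding)‖ := by
  rw [shiftConj_apply_apply]
  simp [sortSign]

theorem norm_shiftConj_iterate_le [NeZero d] {A : SampleMat d} {C : ℝ} (hA : ∀ S T, ‖A S T‖ ≤ C)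
    (t : ℕ) (S T : Finset (Fin d)) : ‖shiftConj^[t] A S T‖ ≤ C := by
  induction t generalizing S T with
  | zero => exact hA S T
  | succ t ih =>
    rw [Function.iterate_succ_apply', norm_shiftConj_apply]
    exact ih _ _

theorem shiftConj_iterate_apply_self [NeZero d] (A : SampleMat d) (t : ℕ) (S : Finset (Fin d)) :
    shiftConj^[t] A S S = A (S.map (sampleShift d ^ t).toEmbedding)
      (S.map (sampleShift d ^ t).toEmbedding) := by
  induction t generalizing S with
  | zero =>
    have : S.map ((sampleShift d) ^ 0).toEmbedding = S := Finset.map_refl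
    rw [this]
    rfl
  | succ t ih =>
    rw [Function.iterate_succ_apply', shiftConj_apply_self, ih, Finset.map_map]
    rfl

theorem sampleShift_pow_apply [NeZero d] (t : ℕ) (j : Fin d) :
    (sampleShift d ^ t) j = j - Fin.ofNat d t := by
  induction t with
  | zero =>
    change j = j - 0
    rw [sub_zero]
  | succ t ih =>
    have h1 : Fin.ofNat d (t + 1) = Fin.ofNat d t + 1 := by
      ext
      simp [Fin.val_add]
    rw [pow_succ', Equiv.Perm.mul_apply, ih, h1, ← sub_sub]
    rfl

theorem sampleShift_pow_mul [NeZero d] (m : ℕ) : sampleShift d ^ (m * d) = 1 := by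
  ext1 j
  have h : Fin.ofNat d (m * d) = 0 := by
    ext
    simp
  rw [sampleShift_pow_apply, h, sub_zero]
  rfl

/-- On the diagonal the reordering signs occur squared, so periodicity of the index permutation
suffices. Off the diagonal only the uniform bound `norm_shiftConj_iterate_le` is needed. -/
theorem shiftConj_iterate_mul_apply_self [NeZero d] (A : SampleMat d) (m : ℕ)
    (S : Finset (Fin d)) : shiftConj^[m * d] A S S = A S S := by
  have : S.map ((1 : Equiv.Perm (Fin d))).toEmbedding = S := Finset.map_refl
  rw [shiftConj_iterate_apply_self, sampleShift_pow_mul, this]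

/-! ### Unfolding the iterated reduced step into site maps. -/

theorem shiftConj_annMat [NeZero d] (j : Fin d) : shiftConj (annMat j) = annMat (j + 1) := by
  have h : shiftConj (star (annMat j)) = star (annMat (j + 1)) := by
    have h := congrArg toMat (secondQuant_conj_creat (sampleShift d) j)
    rw [toMat_mul, toMat_mul, toMat_star, toMat_creat, toMat_creat] at h
    rw [shiftConj_apply]
    exact h
  rw [map_star] at h
  exact star_injective h

theorem shiftConj_siteMap [NeZero d] (α σ : ℝ) (j : Fin d) (A : SampleMat d) :
    shiftConj (siteMap α σ j A) = siteMap α σ (j + 1) (shiftConj A) := by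
  simp only [siteMap, map_add, map_smul, map_mul, map_star, shiftConj_annMat]

theorem shiftConj_foldr [NeZero d] (α σ : ℝ) (l : List (Fin d)) (A : SampleMat d) :
    shiftConj (l.foldr (siteMap α σ) A) = (l.map (· + 1)).foldr (siteMap α σ) (shiftConj A) := by
  induction l with
  | nil => rfl
  | cons j l ih => rw [List.foldr_cons, shiftConj_siteMap, ih, List.map_cons, List.foldr_cons]

/-- Each shift moved inwards raises by one the site of every map that it crosses, so `t` steps visit
the sites `0, …, t - 1` modulo `d`. -/
theorem reducedStep_iterate [NeZero d] (α σ : ℝ) (A : SampleMat d) (t : ℕ) :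
    (reducedStep α σ)^[t] A =
      ((List.range t).map (Fin.ofNat d)).foldr (siteMap α σ) (shiftConj^[t] A) := by
  induction t with
  | zero => rfl
  | succ t ih =>
    rw [Function.iterate_succ_apply', ih, reducedStep, shiftConj_foldr, List.range_succ_eq_map,
      List.map_cons, List.foldr_cons, List.map_map, List.map_map, Function.iterate_succ_apply']
    congr 3
    funext i
    ext
    simp [Fin.val_add]

/-- Each block of `d` consecutive times visits every site once; this is where the times `m * d`
enter. -/
theorem count_range_map_ofNat [NeZero d] (m : ℕ) (k : Fin d) :
    ((List.range (m * d)).map (Fin.ofNat d)).count k = m := by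
  induction m with
  | zero => simp
  | succ m ih =>
    have h : ((List.range d).map (m * d + ·)).map (Fin.ofNat d) = List.finRange d := by
      refine List.ext_getElem (by simp) fun i h1 h2 => ?_
      ext
      simp at h2
      simp [Nat.mod_eq_of_lt h2]
    rw [add_mul, one_mul, List.range_add, List.map_append, List.count_append, ih, h,
      List.count_eq_one_of_mem (List.nodup_finRange d) (List.mem_finRange k)]

/-! ### Decay of the off-diagonal elements. -/

/-- The pairs `(S, T)` that differ at `k` form a class stable under all site maps. The map at `k`
contracts it by `|cos α|`; the map at another site either multiplies by `cos α` or takes, up to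
sign, a convex combination of two entries of the class. -/
theorem norm_siteMap_le {α σ : ℝ} (hσ₀ : 0 ≤ σ) (hσ₁ : σ ≤ 1) (i k : Fin d) {A : SampleMat d}
    {C : ℝ} (hA : ∀ S T, ¬(k ∈ S ↔ k ∈ T) → ‖A S T‖ ≤ C) {S T : Finset (Fin d)}
    (h : ¬(k ∈ S ↔ k ∈ T)) :
    ‖siteMap α σ i A S T‖ ≤ (if i = k then |Real.cos α| else 1) * C := by
  have hST := hA S T h
  have hC : 0 ≤ C := (norm_nonneg _).trans hST
  have hcs := Real.sin_sq_add_cos_sq α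
  have hmix : ∀ (p q : ℝ) (a b : ℂ), 0 ≤ p → 0 ≤ q → p + q = 1 → ‖a‖ ≤ C → ‖b‖ ≤ C →
      ‖(p : ℂ) * a + (q : ℂ) * b‖ ≤ C := by
    intro p q a b hp hq hpq ha hb
    calc ‖(p : ℂ) * a + (q : ℂ) * b‖ ≤ ‖(p : ℂ) * a‖ + ‖(q : ℂ) * b‖ := norm_add_le _ _
      _ = p * ‖a‖ + q * ‖b‖ := by
        rw [norm_mul, norm_mul, Complex.norm_of_nonneg hp, Complex.norm_of_nonneg hq]
      _ ≤ p * C + q * C := by gcongr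
      _ = C := by rw [← add_mul, hpq, one_mul]
  have hsign : ∀ x : ℂ, ‖fermiSign i S * fermiSign i T * x‖ = ‖x‖ := by
    simp [norm_fermiSign]
  have hcos : ‖(Real.cos α : ℂ) * A S T‖ ≤ |Real.cos α| * C := by
    rw [norm_mul, Complex.norm_real, Real.norm_eq_abs]
    gcongr
  rw [siteMap_apply]
  by_cases hik : i = k
  · subst hik
    rw [if_pos rfl]
    split_ifs <;> first | exact hcos | (exfalso; tauto)
  · have hki : k ≠ i := Ne.symm hik
    rw [if_neg hik, one_mul]
    have hle : |Real.cos α| * C ≤ C := mul_le_of_le_one_left hC (Real.abs_cos_le_one α)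
    split_ifs
    · have := hmix (σ + (1 - σ) * Real.cos α ^ 2) ((1 - σ) * Real.sin α ^ 2) (A S T)
        (fermiSign i S * fermiSign i T * A (S.erase i) (T.erase i))
        (by have := sub_nonneg.2 hσ₁; positivity) (by have := sub_nonneg.2 hσ₁; positivity)
        (by linear_combination (1 - σ) * hcs) hST
        (by rw [hsign]; exact hA _ _ (by simpa [hki] using h))
      push_cast at this ⊢
      exact this
    · exact hcos.trans hle
    · exact hcos.trans hle
    · have := hmix (σ * Real.cos α ^ 2 + (1 - σ)) (σ * Real.sin α ^ 2) (A S T)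
        (fermiSign i S * fermiSign i T * A (insert i S) (insert i T))
        (by have := sub_nonneg.2 hσ₁; positivity) (by positivity)
        (by linear_combination σ * hcs) hST
        (by rw [hsign]; exact hA _ _ (by simpa [hki] using h))
      push_cast at this ⊢
      exact this

theorem norm_foldr_siteMap_le {α σ : ℝ} (hσ₀ : 0 ≤ σ) (hσ₁ : σ ≤ 1) (l : List (Fin d)) (k : Fin d)
    {A : SampleMat d} {C : ℝ} (hA : ∀ S T, ‖A S T‖ ≤ C) {S T : Finset (Fin d)}
    (h : ¬(k ∈ S ↔ k ∈ T)) :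
    ‖l.foldr (siteMap α σ) A S T‖ ≤ |Real.cos α| ^ l.count k * C := by
  induction l generalizing S T with
  | nil => simpa using hA S T
  | cons i l ih =>
    rw [List.foldr_cons]
    refine (norm_siteMap_le hσ₀ hσ₁ i k (fun S T h => ih h) h).trans (le_of_eq ?_)
    rw [List.count_cons]
    by_cases hik : i = k
    · simp only [hik, if_true, beq_self_eq_true]
      ring
    · simp [hik]

/-! ### Relaxation of the diagonal elements. -/

/-- The function `S ↦ ∏_j (x_j + y_j (1_{j ∈ S} - σ))`. -/
def occProd (σ : ℝ) (x y : Fin d → ℂ) (S : Finset (Fin d)) : ℂ :=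
  ∏ j, (x j + y j * ((if j ∈ S then 1 else 0) - σ))

theorem occProd_eq_mul (σ : ℝ) (x y : Fin d → ℂ) (S : Finset (Fin d)) (i : Fin d) :
    occProd σ x y S = (x i + y i * ((if i ∈ S then 1 else 0) - σ)) *
      ∏ j ∈ Finset.univ.erase i, (x j + y j * ((if j ∈ S then 1 else 0) - σ)) :=
  (Finset.mul_prod_erase _ _ (Finset.mem_univ i)).symm

/-- In the occupation variable at `i`, the chain has eigenvectors `1` and `1_{i ∈ S} - σ`, with
eigenvalues `1` and `cos² α`. A product function therefore stays a product, only its coefficient `y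
i` being rescaled. -/
theorem siteMap_apply_self {α σ : ℝ} (i : Fin d) {A : SampleMat d} {R : Type*} [Fintype R]
    (c : R → ℂ) (x y : R → Fin d → ℂ) (hA : ∀ S, A S S = ∑ r, c r * occProd σ (x r) (y r) S)
    (S : Finset (Fin d)) :
    siteMap α σ i A S S = ∑ r, c r * occProd σ (x r)
      (fun j => if i = j then (Real.cos α : ℂ) ^ 2 * y r j else y r j) S := by
  have hcs : (Real.sin α : ℂ) ^ 2 = 1 - (Real.cos α : ℂ) ^ 2 := by
    rw [eq_sub_iff_add_eq]
    exact_mod_cast Real.sin_sq_add_cos_sq α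
  rw [siteMap_apply, fermiSign_mul_self, one_mul, one_mul, hA, hA, hA, hcs]
  -- Erasing or inserting `i` leaves all factors but the one at `i` untouched, so the claim reduces
  -- to an identity for that factor.
  have hrest : ∀ (r : R) (T : Finset (Fin d)) (_ : ∀ j, j ≠ i → (j ∈ T ↔ j ∈ S))
      (y' : Fin d → ℂ) (_ : ∀ j, j ≠ i → y' j = y r j),
      occProd σ (x r) y' T = (x r i + y' i * ((if i ∈ T then 1 else 0) - σ)) *
      ∏ j ∈ Finset.univ.erase i, (x r j + y r j * ((if j ∈ S then 1 else 0) - σ)) := by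
    intro r T hT y' hy'
    rw [occProd_eq_mul _ _ _ _ i]
    congr 1
    refine Finset.prod_congr rfl fun j hj => ?_
    have hj' := Finset.ne_of_mem_erase hj
    rw [hy' j hj']
    simp only [hT j hj']
  have e1 : ∀ r, occProd σ (x r) (y r) S = _ := fun r =>
    hrest r S (fun _ _ => Iff.rfl) (y r) fun _ _ => rfl
  have e2 : ∀ r, occProd σ (x r) (y r) (S.erase i) = _ := fun r =>
    hrest r (S.erase i) (fun j hj => by simp [hj]) (y r) fun _ _ => rfl
  have e3 : ∀ r, occProd σ (x r) (y r) (insert i S) = _ := fun r =>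
    hrest r (insert i S) (fun j hj => by simp [hj]) (y r) fun _ _ => rfl
  have e4 : ∀ r, occProd σ (x r)
      (fun j => if i = j then (Real.cos α : ℂ) ^ 2 * y r j else y r j) S = _ := fun r =>
    hrest r S (fun _ _ => Iff.rfl) _ fun j hj => if_neg (Ne.symm hj)
  simp only [e1, e2, e3, e4]
  split_ifs with h <;> simp [-Complex.ofReal_cos] at * <;>
    rw [Finset.mul_sum, Finset.mul_sum, ← Finset.sum_add_distrib] <;>
    refine Finset.sum_congr rfl fun r _ => ?_ <;> ring

theorem foldr_siteMap_apply_self {α σ : ℝ} (l : List (Fin d)) {A : SampleMat d} {R : Type*}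
    [Fintype R] (c : R → ℂ) (x y : R → Fin d → ℂ)
    (hA : ∀ S, A S S = ∑ r, c r * occProd σ (x r) (y r) S) (S : Finset (Fin d)) :
    l.foldr (siteMap α σ) A S S = ∑ r, c r * occProd σ (x r)
      (fun j => ((Real.cos α : ℂ) ^ 2) ^ l.count j * y r j) S := by
  induction l generalizing S with
  | nil => simpa using hA S
  | cons i l ih =>
    rw [List.foldr_cons, siteMap_apply_self i c x _ ih]
    congr! 4 with r _ j
    rw [List.count_cons]
    by_cases hij : i = j
    · simp only [hij, if_true, beq_self_eq_true]
      ring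
    · simp [hij]

/-- The probability of the occupied set `S` when sites are independently occupied with
probability `σ`. -/
def occWeight (σ : ℝ) (S : Finset (Fin d)) : ℂ := ∏ j, if j ∈ S then (σ : ℂ) else 1 - σ

/-- The expectation of a sample observable in the quasi-free state with density `σ`. -/
def occExpect (σ : ℝ) (A : SampleMat d) : ℂ := ∑ S, occWeight σ S * A S S

/-- The indicator of a configuration is a product over sites: `1_{j ∈ T} = σ + (1_{j ∈ T} - σ)` and
`1 - 1_{j ∈ T} = (1 - σ) - (1_{j ∈ T} - σ)`. Its constant parts multiply to `occWeight`. -/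
theorem occProd_eq_ite (σ : ℝ) (S T : Finset (Fin d)) :
    occProd σ (fun j => if j ∈ S then (σ : ℂ) else 1 - σ) (fun j => if j ∈ S then 1 else -1) T =
      if S = T then 1 else 0 := by
  split_ifs with h
  · subst h
    refine Finset.prod_eq_one fun j _ => ?_
    by_cases h : j ∈ S <;> simp [h]
  · have : ∃ j, ¬(j ∈ S ↔ j ∈ T) := by
      by_contra! hc
      exact h (Finset.ext hc)
    obtain ⟨j, hj⟩ := this
    refine Finset.prod_eq_zero (Finset.mem_univ j) ?_
    by_cases h1 : j ∈ S <;> by_cases h2 : j ∈ T <;> simp_all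

theorem tendsto_reducedStep [NeZero d] {α σ : ℝ} (hα : |Real.cos α| < 1) (hσ₀ : 0 ≤ σ)
    (hσ₁ : σ ≤ 1) (A : SampleMat d) (S T : Finset (Fin d)) :
    Tendsto (fun m : ℕ => (reducedStep α σ)^[m * d] A S T) atTop
      (𝓝 (if S = T then occExpect σ A else 0)) := by
  simp only [reducedStep_iterate]
  split_ifs with h
  · subst h
    -- The diagonal is expanded in indicators with coefficients independent of `m`; as `cos² α` to
    -- the power `m` tends to zero, only the constant parts of the factors survive.
    have hd : ∀ m S, shiftConj^[m * d] A S S = ∑ R, A R R *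
        occProd σ (fun j => if j ∈ R then (σ : ℂ) else 1 - σ) (fun j => if j ∈ R then 1 else -1)
          S := by
      intro m S
      rw [shiftConj_iterate_mul_apply_self]
      simp [occProd_eq_ite]
    simp only [foldr_siteMap_apply_self _ _ _ _ (hd _), count_range_map_ofNat]
    refine tendsto_finsetSum _ fun R _ => ?_
    rw [mul_comm]
    refine Tendsto.const_mul _ ?_
    have hc : Tendsto (fun m : ℕ => ((Real.cos α : ℂ) ^ 2) ^ m) atTop (𝓝 0) := by
      refine tendsto_pow_atTop_nhds_zero_of_norm_lt_one ?_
      rw [norm_pow, Complex.norm_real, Real.norm_eq_abs]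
      exact pow_lt_one₀ (abs_nonneg _) hα two_ne_zero
    refine tendsto_finsetProd _ fun j _ => ?_
    refine (tendsto_const_nhds.add ((hc.mul_const _).mul_const _)).trans_eq ?_
    rw [zero_mul, zero_mul, add_zero]
  · have : ∃ k, ¬(k ∈ S ↔ k ∈ T) := by
      by_contra! hc
      exact h (Finset.ext hc)
    obtain ⟨k, hk⟩ := this
    have hA : ∀ S T, ‖A S T‖ ≤ ∑ S, ∑ T, ‖A S T‖ := fun S T =>
      (Finset.single_le_sum (f := fun T => ‖A S T‖) (fun _ _ => norm_nonneg _)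
        (Finset.mem_univ T)).trans
      (Finset.single_le_sum (f := fun S => ∑ T, ‖A S T‖)
        (fun _ _ => Finset.sum_nonneg fun _ _ => norm_nonneg _) (Finset.mem_univ S))
    have hlim := (tendsto_pow_atTop_nhds_zero_of_lt_one (abs_nonneg _) hα).mul_const
      (∑ S, ∑ T, ‖A S T‖)
    rw [zero_mul] at hlim
    refine squeeze_zero_norm (fun m => ?_) hlim
    have := norm_foldr_siteMap_le (α := α) hσ₀ hσ₁ ((List.range (m * d)).map (Fin.ofNat d)) k
      (norm_shiftConj_iterate_le hA (m * d)) hk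
    rwa [count_range_map_ofNat] at this

/-! ### The trace in coordinates and the limit of the sample state. -/

/-- Coordinates in the occupation number basis. -/
def fockEquiv (d : ℕ) : Fock (Fin d) ≃ₗ[ℂ] (Finset (Fin d) → ℂ) where
  toFun f S := f S
  map_add' _ _ := rfl
  map_smul' _ _ := rfl
  invFun g := ∑ S, g S • basisVec S
  left_inv f := (eq_sum_basisVec f).symm
  right_inv g := by
    ext T
    change (∑ S, g S • basisVec S : Fock (Fin d)) T = g T
    rw [lp.coeFn_sum, Finset.sum_apply]
    simp [basisVec_apply]

theorem tr_eq_sum (A : SampleOp d) : tr A = ∑ S, toMat A S S := by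
  rw [tr, LinearMap.trace_eq_matrix_trace ℂ (Module.Basis.ofEquivFun (fockEquiv d))]
  refine Finset.sum_congr rfl fun S _ => ?_
  have : (Module.Basis.ofEquivFun (fockEquiv d)) S = basisVec S := by
    rw [Module.Basis.coe_ofEquivFun]
    change ∑ T, (Function.update (0 : Finset (Fin d) → ℂ) S 1) T • basisVec T = _
    simp [Function.update_apply]
  rw [Matrix.diag_apply, LinearMap.toMatrix_apply, this]
  rfl

theorem tendsto_sampleState [NeZero d] {α σ : ℝ} (hα : |Real.cos α| < 1) (hσ₀ : 0 ≤ σ)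
    (hσ₁ : σ ≤ 1) {ω : CAR ℤ →L[ℂ] ℂ}
    (hqf : IsQuasiFree ω ((σ : ℂ) • ContinuousLinearMap.id ℂ ℓ²(ℤ, ℂ)))
    {ρ : SampleOp d} (hρ : tr ρ = 1) (A : SampleOp d) :
    Tendsto (fun m : ℕ => sampleState α ω ρ (m * d) A) atTop (𝓝 (occExpect σ (toMat A))) := by
  simp only [sampleState_eq α hqf]
  -- The limiting observable is a scalar, so pairing it with `ρ` yields that scalar times `tr ρ =
  -- 1`.
  have h : occExpect σ (toMat A) =
      ∑ S, ∑ T, toMat ρ T S * (if S = T then occExpect σ (toMat A) else 0) := by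
    simp [← Finset.sum_mul, ← tr_eq_sum, hρ]
  rw [h]
  exact tendsto_finsetSum _ fun S _ => tendsto_finsetSum _ fun T _ =>
    (tendsto_reducedStep hα hσ₀ hσ₁ (toMat A) S T).const_mul _

end Convergence

/-! ### Observables of the sample in the limiting state -/

section Observables

variable {d : ℕ}

theorem sum_prod_ite_mem {ι : Type*} [Fintype ι] [DecidableEq ι] (f g : ι → ℂ) :
    ∑ S : Finset ι, ∏ j, (if j ∈ S then f j else g j) = ∏ j, (f j + g j) := by
  rw [Finset.prod_add, Finset.powerset_univ]
  refine Finset.sum_congr rfl fun S _ => ?_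
  rw [Finset.prod_ite]
  congr 2 <;> ext <;> simp

/-- The constraint `K ⊆ S` is absorbed into the product by giving weight zero to an empty site of
`K`; the sum over `S` then factorizes over sites. -/
theorem sum_occWeight_superset (σ : ℝ) (K : Finset (Fin d)) :
    ∑ S, occWeight σ S * (if K ⊆ S then 1 else 0) = (σ : ℂ) ^ K.card := by
  have h : ∀ S : Finset (Fin d), occWeight σ S * (if K ⊆ S then 1 else 0) =
      ∏ j, if j ∈ S then (σ : ℂ) else if j ∈ K then 0 else 1 - σ := by
    intro S
    split_ifs with hK
    · rw [mul_one, occWeight]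
      refine Finset.prod_congr rfl fun j _ => ?_
      by_cases hj : j ∈ S
      · simp [hj]
      · have : j ∉ K := fun h => hj (hK h)
        simp [hj, this]
    · obtain ⟨j, hjK, hjS⟩ := Finset.not_subset.1 hK
      rw [mul_zero, Finset.prod_eq_zero (Finset.mem_univ j)]
      simp [hjK, hjS]
  simp only [h]
  rw [sum_prod_ite_mem]
  have h2 : ∀ j, ((σ : ℂ) + if j ∈ K then 0 else 1 - (σ : ℂ)) = if j ∈ K then (σ : ℂ) else 1 := by
    intro j
    split_ifs <;> ring
  simp only [h2]
  rw [Finset.prod_ite_mem, Finset.univ_inter, Finset.prod_const]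

theorem sum_occWeight (σ : ℝ) : ∑ S : Finset (Fin d), occWeight σ S = 1 := by
  simpa using sum_occWeight_superset (d := d) σ ∅

theorem occWeight_eq (σ : ℝ) (S : Finset (Fin d)) :
    occWeight σ S = (σ : ℂ) ^ S.card * (1 - σ) ^ (d - S.card) := by
  have h1 : Finset.univ.filter (· ∈ S) = S := by ext; simp
  rw [occWeight, Finset.prod_ite, Finset.prod_const, Finset.prod_const, Finset.filter_not, h1,
    ← Finset.compl_eq_univ_sdiff, Finset.card_compl, Fintype.card_fin]

/-! #### Reduced density matrices -/

/-- The sign is never computed, since it will be multiplied by its conjugate. What matters is that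
it does not depend on `f`. -/
theorem list_creat_prod_apply (l : List (Fin d)) (hl : l.Nodup) (S : Finset (Fin d)) :
    ∃ s : ℂ, s * star s = 1 ∧ ∀ f : Fock (Fin d), (l.map creat).prod f S =
      if l.toFinset ⊆ S then s * f (S \ l.toFinset) else 0 := by
  induction l generalizing S with
  | nil => exact ⟨1, by simp, fun f => by simp⟩
  | cons i l ih =>
    obtain ⟨hi, hl⟩ := List.nodup_cons.1 hl
    obtain ⟨s, hs, h⟩ := ih hl (S.erase i)
    refine ⟨fermiSign i S * s, ?_, fun f => ?_⟩
    · rw [star_mul', star_fermiSign, mul_mul_mul_comm, fermiSign_mul_self, hs, one_mul]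
    · have h1 : ((i :: l).map creat).prod f S = creat i ((l.map creat).prod f) S := rfl
      rw [h1, creat_apply, h]
      have h2 : l.toFinset ⊆ S.erase i ↔ l.toFinset ⊆ S := by
        rw [Finset.subset_erase]
        simp [hi]
      have h3 : S.erase i \ l.toFinset = S \ insert i l.toFinset := by
        ext x
        simp
        tauto
      simp only [List.toFinset_cons, Finset.insert_subset_iff, h2, h3]
      by_cases h4 : i ∈ S <;> by_cases h5 : l.toFinset ⊆ S <;> simp [h4, h5, mul_assoc]

theorem creatProd_apply (K S : Finset (Fin d)) :
    ∃ s : ℂ, s * star s = 1 ∧ ∀ f : Fock (Fin d), creatProd K f S =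
      if K ⊆ S then s * f (S \ K) else 0 := by
  have h := list_creat_prod_apply (K.sort (· ≤ ·)) (Finset.sort_nodup K _) S
  rwa [Finset.sort_toFinset] at h

theorem toMat_creatProd_mul_star (J K S : Finset (Fin d)) (h : J.card = K.card) :
    toMat (creatProd K * star (creatProd J)) S S = if J = K ∧ K ⊆ S then 1 else 0 := by
  obtain ⟨s, hs, hK⟩ := creatProd_apply K S
  obtain ⟨s', -, hJ⟩ := creatProd_apply J S
  rw [toMat_mul, toMat_star, Matrix.mul_apply]
  simp only [Matrix.star_apply, toMat_apply, hK, hJ, basisVec_apply]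
  by_cases h1 : K ⊆ S
  · by_cases h2 : J ⊆ S
    · by_cases h3 : J = K
      · subst h3
        -- The two signs come from separate existence statements; evaluating on `basisVec (S \ J)`
        -- identifies them.
        have h4 : s = s' := by
          have e1 := hK (basisVec (S \ J))
          have e2 := hJ (basisVec (S \ J))
          rw [e1] at e2
          simpa [h1, basisVec_apply] using e2
        subst h4
        simp only [h1, and_self, if_true]
        rw [Finset.sum_eq_single (S \ J)]
        · simpa using hs
        · intro U _ hU
          simp [Ne.symm hU]
        · simp
      · have h4 : S \ K ≠ S \ J := fun h => h3 (by
          rw [← Finset.sdiff_sdiff_eq_self h1, ← Finset.sdiff_sdiff_eq_self h2, h])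
        rw [if_neg (by tauto)]
        refine Finset.sum_eq_zero fun U _ => ?_
        by_cases h5 : S \ K = U
        · have h6 : S \ J ≠ U := fun h => h4 (h5.trans h.symm)
          simp [h6]
        · simp [h5]
    · have : J ≠ K := fun h => h2 (h ▸ h1)
      simp [h2, this]
  · simp [h1]

theorem occExpect_creatProd (σ : ℝ) (J K : Finset (Fin d)) (h : J.card = K.card) :
    occExpect σ (toMat (creatProd K * star (creatProd J))) =
      if J = K then (σ : ℂ) ^ K.card else 0 := by
  simp only [occExpect, toMat_creatProd_mul_star J K _ h]
  split_ifs with hJK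
  · simpa [hJK] using sum_occWeight_superset σ K
  · simp [hJK]

/-! #### The number operator -/

theorem numberOp_apply (f : Fock (Fin d)) (S : Finset (Fin d)) :
    numberOp d f S = S.card * f S := by
  have h : numberOp d f = ∑ i, creat i (annih i f) := by
    rw [numberOp, sum_apply]
    rfl
  rw [h, lp.coeFn_sum, Finset.sum_apply]
  have h2 : ∀ i, creat i (annih i f) S = if i ∈ S then f S else 0 := by
    intro i
    rw [creat_apply, annih_apply]
    split_ifs with hi hi'
    · simp at hi'
    · rw [Finset.insert_erase hi, fermiSign_erase, ← mul_assoc, fermiSign_mul_self, one_mul]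
    · simp
    · simp
  simp [h2]

/-- The exponential series is applied to `f` and paired with `basisVec S`; both operations are
continuous, and the number operator is diagonal. -/
theorem exp_numberOp_apply (c : ℂ) (f : Fock (Fin d)) (S : Finset (Fin d)) :
    NormedSpace.exp (c • numberOp d) f S = Complex.exp (c * S.card) * f S := by
  have h1 := NormedSpace.exp_series_hasSum_exp' (𝕂 := ℂ) (c • numberOp d)
  have h2 := (h1.mapL (ContinuousLinearMap.apply ℂ (Fock (Fin d)) f)).mapL
    (innerSL ℂ (basisVec S))
  have h3 : HasSum (fun n : ℕ => (c * S.card) ^ n / (n.factorial : ℂ)) (Complex.exp (c * S.card)) := by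
    rw [Complex.exp_eq_exp_ℂ]
    exact NormedSpace.expSeries_div_hasSum_exp _
  have hpow : ∀ n : ℕ, ((c • numberOp d) ^ n) f S = (c * S.card) ^ n * f S := by
    intro n
    induction n with
    | zero => simp
    | succ n ih =>
      have : ((c • numberOp d) ^ (n + 1)) f = c • numberOp d (((c • numberOp d) ^ n) f) := by
        rw [pow_succ']
        rfl
      rw [this, lp.coeFn_smul, Pi.smul_apply, numberOp_apply, ih, smul_eq_mul]
      ring
  have h4 := h3.mul_right (f S)
  have h5 : (fun n : ℕ => innerSL ℂ (basisVec S) (ContinuousLinearMap.apply ℂ (Fock (Fin d)) f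
      ((n.factorial : ℂ)⁻¹ • (c • numberOp d) ^ n))) =
      fun n : ℕ => (c * S.card) ^ n / (n.factorial : ℂ) * f S := by
    ext1 n
    change ⟪basisVec S, (n.factorial : ℂ)⁻¹ • ((c • numberOp d) ^ n) f⟫_ℂ = _
    rw [inner_basisVec, lp.coeFn_smul, Pi.smul_apply, hpow, smul_eq_mul]
    ring
  rw [h5] at h2
  rw [← inner_basisVec S]
  exact h2.unique h4

/-- With `e^{-μ} = σ / (1 - σ)`, multiplying by `(1 - σ)^d` turns the Gibbs weight into the product
of site probabilities. -/
theorem exp_neg_log_mul {σ : ℝ} (h₀ : 0 < σ) (h₁ : σ < 1) (S : Finset (Fin d)) :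
    Complex.exp (-(Real.log ((1 - σ) / σ) : ℂ) * S.card) =
      (((1 - σ) ^ d : ℝ) : ℂ)⁻¹ * occWeight σ S := by
  have h1 : 0 < 1 - σ := sub_pos.2 h₁
  have hne : (1 - (σ : ℂ)) ≠ 0 := by exact_mod_cast h1.ne'
  have h2 : Complex.exp (-(Real.log ((1 - σ) / σ) : ℂ)) = σ / (1 - σ) := by
    rw [← Complex.ofReal_neg, ← Complex.ofReal_exp, Real.exp_neg, Real.exp_log (by positivity)]
    push_cast
    rw [inv_div]
  have hcard : S.card ≤ d := by simpa using Finset.card_le_univ S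
  rw [mul_comm, Complex.exp_nat_mul, h2, occWeight_eq]
  push_cast
  rw [div_pow, div_eq_iff (pow_ne_zero _ hne)]
  have : (1 - (σ : ℂ)) ^ d = (1 - σ) ^ (d - S.card) * (1 - σ) ^ S.card := by
    rw [← pow_add, Nat.sub_add_cancel hcard]
  rw [this]
  field_simp

theorem partitionFn_eq {σ : ℝ} (h₀ : 0 < σ) (h₁ : σ < 1) :
    partitionFn d (Real.log ((1 - σ) / σ)) = (((1 - σ) ^ d : ℝ) : ℂ)⁻¹ := by
  rw [partitionFn, tr_eq_sum]
  simp only [toMat_apply, exp_numberOp_apply, basisVec_apply, if_true, mul_one,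
    exp_neg_log_mul h₀ h₁]
  rw [← Finset.mul_sum, sum_occWeight, mul_one]

theorem tr_gibbs_mul {σ : ℝ} (h₀ : 0 < σ) (h₁ : σ < 1) (A : SampleOp d) :
    tr (gibbs d (Real.log ((1 - σ) / σ)) * A) = occExpect σ (toMat A) := by
  have hne : (((1 - σ) ^ d : ℝ) : ℂ) ≠ 0 := by
    exact_mod_cast (pow_pos (sub_pos.2 h₁) d).ne'
  rw [tr_eq_sum, occExpect, gibbs, partitionFn_eq h₀ h₁, inv_inv]
  refine Finset.sum_congr rfl fun S _ => ?_
  rw [smul_mul_assoc, toMat_smul, Matrix.smul_apply, smul_eq_mul, toMat_apply, toMat_apply]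
  change _ * NormedSpace.exp (-(Real.log ((1 - σ) / σ) : ℂ) • numberOp d) (A (basisVec S)) S = _
  rw [exp_numberOp_apply, exp_neg_log_mul h₀ h₁, ← mul_assoc, mul_inv_cancel_left₀ hne]

theorem toMat_numberProj (p : ℕ) (S : Finset (Fin d)) :
    toMat (numberProj d p) S S = if S.card = p then 1 else 0 := by
  set V := Module.End.eigenspace (numberOp d : Module.End ℂ (Fock (Fin d))) (p : ℂ) with hV
  have hmem : ∀ f : Fock (Fin d), f ∈ V ↔ numberOp d f = (p : ℂ) • f := fun f =>
    Module.End.mem_eigenspace_iff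
  rw [toMat_apply]
  change V.starProjection (basisVec S) S = _
  split_ifs with h
  · have : basisVec S ∈ V := by
      rw [hmem]
      ext T
      rw [numberOp_apply, lp.coeFn_smul, Pi.smul_apply, smul_eq_mul, basisVec_apply]
      by_cases hT : T = S <;> simp [hT, h]
    rw [Submodule.starProjection_eq_self_iff.2 this, basisVec_apply, if_pos rfl]
  · have h1 : V.starProjection (basisVec S) ∈ V := Submodule.starProjection_apply_mem _ _
    have h2 := congrArg (fun f : Fock (Fin d) => f S) ((hmem _).1 h1)
    simp only [numberOp_apply, lp.coeFn_smul, Pi.smul_apply, smul_eq_mul] at h2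
    by_contra h3
    exact h (Nat.cast_injective (R := ℂ) (mul_right_cancel₀ h3 h2))

theorem occExpect_numberProj (σ : ℝ) (p : ℕ) :
    occExpect σ (toMat (numberProj d p)) =
      (((d.choose p : ℝ) * σ ^ p * (1 - σ) ^ (d - p) : ℝ) : ℂ) := by
  have h : ∀ S : Finset (Fin d), occWeight σ S * (if S.card = p then 1 else 0) =
      if S.card = p then (σ : ℂ) ^ p * (1 - σ) ^ (d - p) else 0 := by
    intro S
    rw [occWeight_eq]
    split_ifs with hS
    · rw [hS, mul_one]
    · rw [mul_zero]
  simp only [occExpect, toMat_numberProj, h]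
  rw [← Finset.sum_filter, Finset.sum_const, Finset.univ_filter_card_eq, Finset.card_powersetCard,
    Finset.card_univ, Fintype.card_fin, nsmul_eq_mul]
  push_cast
  ring

end Observables

end FermionWalk

end

/-! ### The three limits as values of the product expectation. -/

theorem mainTheorem9 (d : ℕ) [NeZero d] (α σ : ℝ) (hα : |Real.cos α| < 1) (hσ₀ : 0 ≤ σ)
    (hσ₁ : σ ≤ 1) (ω : FermionWalk.CAR ℤ →L[ℂ] ℂ) (hω : FermionWalk.IsState ω)
    (hqf : FermionWalk.IsQuasiFree ω ((σ : ℂ) • ContinuousLinearMap.id ℂ ℓ²(ℤ, ℂ)))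
    (ρ : FermionWalk.SampleOp d) (hρ : FermionWalk.IsDensityMatrix ρ) :
    (∀ p : ℕ, 1 ≤ p → p ≤ d →
      Tendsto (fun m : ℕ =>
          FermionWalk.reducedDensityMatrix p (FermionWalk.sampleState α ω ρ (m * d)))
        atTop (𝓝 ((σ : ℂ) ^ p • 1))) ∧
    (0 < σ → σ < 1 →
      FermionWalk.partitionFn d (Real.log ((1 - σ) / σ)) = (((1 - σ) ^ d : ℝ) : ℂ)⁻¹ ∧
      ∀ A : FermionWalk.SampleOp d,
        Tendsto (fun m : ℕ => FermionWalk.sampleState α ω ρ (m * d) A) atTop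
          (𝓝 (FermionWalk.tr (FermionWalk.gibbs d (Real.log ((1 - σ) / σ)) * A)))) ∧
    (∀ p : ℕ,
      Tendsto (fun m : ℕ => FermionWalk.sampleState α ω ρ (m * d) (FermionWalk.numberProj d p))
        atTop (𝓝 (((d.choose p : ℝ) * σ ^ p * (1 - σ) ^ (d - p) : ℝ) : ℂ))) := by
  refine ⟨fun p _ _ => ?_, fun h₀ h₁ => ⟨FermionWalk.partitionFn_eq h₀ h₁, fun A => ?_⟩,
    fun p => ?_⟩
  · refine tendsto_pi_nhds.2 fun J => tendsto_pi_nhds.2 fun K => ?_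
    have h := FermionWalk.tendsto_sampleState hα hσ₀ hσ₁ hqf hρ.tr_eq_one
      (FermionWalk.creatProd K.1 * star (FermionWalk.creatProd J.1))
    rw [FermionWalk.occExpect_creatProd σ J.1 K.1 (J.2.trans K.2.symm), K.2] at h
    have hlim : ((σ : ℂ) ^ p • (1 : Matrix {J : Finset (Fin d) // J.card = p}
        {J : Finset (Fin d) // J.card = p} ℂ)) J K = if J.1 = K.1 then (σ : ℂ) ^ p else 0 := by
      simp [Matrix.one_apply, Subtype.ext_iff]
    rw [hlim]
    exact h
  · rw [FermionWalk.tr_gibbs_mul h₀ h₁]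
    exact FermionWalk.tendsto_sampleState hα hσ₀ hσ₁ hqf hρ.tr_eq_one A
  · rw [← FermionWalk.occExpect_numberProj]
    exact FermionWalk.tendsto_sampleState hα hσ₀ hσ₁ hqf hρ.tr_eq_one _
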